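/- Let $d \geq 1$. For $u \in L^1(\mathbb{R}^d)$ put \[ \|Du\|(\mathbb{R}^d) = \sup\left\{ \int_{\mathbb{R}^d} u \operatorname{div} v : v \in C^1_c(\mathbb{R}^d;\mathbb{R}^d),\ |v(x)| \leq 1 \text{ for all } x \right\}, \] and, when this is finite, let $Du$ denote the distributional gradient of $u$, which is the finite $\mathbb{R}^d$-valued Borel measure with $\int u \operatorname{div} v = -\int v \cdot dDu$ for all $v \in C^1_c(\mathbb{R}^d;\mathbb{R}^d)$. Let $BV([0,1]^d)$ be the space of those $u \in L^1(\mathbb{R}^d)$ with $u = 0$ a.e. on $\mathbb{R}^d \setminus [0,1]^d$ and $\|Du\|(\mathbb{R}^d) < \infty$, normed by $\|u\|_{BV} = \|Du\|(\mathbb{R}^d)$, and let $BV([0,1]^d)^*$ be its topological dual. For $v \in C([0,1]^d;\mathbb{R}^d)$ let $\operatorname{div} v \in BV([0,1]^d)^*$ be the functional $(\operatorname{div} v)(u) = -\int_{[0,1]^d} v \cdot dDu$, and let the space of strong charges be $CH([0,1]^d) = \{\operatorname{div} v : v \in C([0,1]^d;\mathbb{R}^d)\} \subset BV([0,1]^d)^*$.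 Proposition. Let $\omega \in BV([0,1]^d)^*$. The following are equivalent. (1) $\omega \in CH([0,1]^d)$. (2) For every sequence $(u_n)$ in $BV([0,1]^d)$ and every $u \in BV([0,1]^d)$ such that $u_n \to u$ in $L^1$ and $\sup_n \|Du_n\|(\mathbb{R}^d) < \infty$, one has $\omega(u_n) \to \omega(u)$. -/

import Mathlib

open MeasureTheory Filter Topology Set
open scoped ENNReal

noncomputable section

/-- Euclidean space `ℝ^d`, with the Euclidean norm. -/
abbrev Rd (d : ℕ) : Type := EuclideanSpace ℝ (Fin d)

/-- The unit cube `[0,1]^d`. -/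
def unitCube (d : ℕ) : Set (Rd d) := {x | ∀ i, 0 ≤ x i ∧ x i ≤ 1}

/-- The divergence `∑ i, ∂ᵢ vᵢ` of a vector field. -/
def divergence {d : ℕ} (v : Rd d → Rd d) (x : Rd d) : ℝ :=
  ∑ i, fderiv ℝ v x (EuclideanSpace.single i 1) i

/-- `v ∈ C¹_c(ℝ^d; ℝ^d)`. -/
def IsTestField {d : ℕ} (v : Rd d → Rd d) : Prop :=
  ContDiff ℝ 1 v ∧ HasCompactSupport v

/-- De Giorgi's variation `‖Du‖(ℝ^d) = sup {∫ u div v : v ∈ C¹_c(ℝ^d; ℝ^d), ‖v‖_∞ ≤ 1}`.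
As `v = 0` is admissible the supremum is nonnegative, so nothing is lost by truncating the negative
integrals at zero. -/
def deGiorgiVariation {d : ℕ} (u : Rd d → ℝ) : ℝ≥0∞ :=
  ⨆ v : {v : Rd d → Rd d // IsTestField v ∧ ∀ x, ‖v x‖ ≤ 1},
    ENNReal.ofReal (∫ x, u x * divergence v.1 x)

theorem deGiorgiVariation_congr {d : ℕ} {u w : Rd d → ℝ} (h : u =ᵐ[volume] w) :
    deGiorgiVariation u = deGiorgiVariation w := by
  unfold deGiorgiVariation
  congr 1
  ext v
  congr 1
  refine integral_congr_ae ?_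
  filter_upwards [h] with x hx
  rw [hx]

theorem IsTestField.continuous_divergence {d : ℕ} {v : Rd d → Rd d} (hv : IsTestField v) :
    Continuous (divergence v) := by
  have h := hv.1.continuous_fderiv one_ne_zero
  unfold divergence
  fun_prop

theorem IsTestField.hasCompactSupport_divergence {d : ℕ} {v : Rd d → Rd d} (hv : IsTestField v) :
    HasCompactSupport (divergence v) := by
  refine (hv.2.fderiv ℝ).mono ?_
  intro x hx
  contrapose! hx
  simp only [Function.mem_support, not_not] at hx
  simp [divergence, hx]

theorem IsTestField.integrable_mul_divergence {d : ℕ} {v : Rd d → Rd d} (hv : IsTestField v)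
    {u : Rd d → ℝ} (hu : Integrable u) : Integrable (fun x => u x * divergence v x) := by
  obtain ⟨C, hC⟩ := hv.hasCompactSupport_divergence.exists_bound_of_continuous
    hv.continuous_divergence
  exact hu.mul_bdd hv.continuous_divergence.aestronglyMeasurable (ae_of_all _ hC)

theorem deGiorgiVariation_zero {d : ℕ} : deGiorgiVariation (fun _ : Rd d => (0 : ℝ)) = 0 := by
  simp [deGiorgiVariation]

theorem deGiorgiVariation_add_le {d : ℕ} {u w : Rd d → ℝ} (hu : Integrable u) (hw : Integrable w) :
    deGiorgiVariation (fun x => u x + w x) ≤ deGiorgiVariation u + deGiorgiVariation w := by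
  refine iSup_le fun v => ?_
  simp only [add_mul]
  rw [integral_add (v.2.1.integrable_mul_divergence hu) (v.2.1.integrable_mul_divergence hw)]
  refine ENNReal.ofReal_add_le.trans (add_le_add ?_ ?_)
  · exact le_iSup (fun v : {v : Rd d → Rd d // IsTestField v ∧ ∀ x, ‖v x‖ ≤ 1} =>
      ENNReal.ofReal (∫ x, u x * divergence v.1 x)) v
  · exact le_iSup (fun v : {v : Rd d → Rd d // IsTestField v ∧ ∀ x, ‖v x‖ ≤ 1} =>
      ENNReal.ofReal (∫ x, w x * divergence v.1 x)) v

theorem deGiorgiVariation_neg {d : ℕ} (u : Rd d → ℝ) :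
    deGiorgiVariation (fun x => -u x) = deGiorgiVariation u := by
  have key : ∀ u : Rd d → ℝ, deGiorgiVariation (fun x => -u x) ≤ deGiorgiVariation u := by
    intro u
    refine iSup_le fun v => ?_
    have hv : IsTestField (fun x => -v.1 x) ∧ ∀ x, ‖-v.1 x‖ ≤ 1 :=
      ⟨⟨v.2.1.1.neg, v.2.1.2.neg⟩, fun x => by rw [norm_neg]; exact v.2.2 x⟩
    refine le_trans (le_of_eq ?_)
      (le_iSup (fun v : {v : Rd d → Rd d // IsTestField v ∧ ∀ x, ‖v x‖ ≤ 1} =>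
        ENNReal.ofReal (∫ x, u x * divergence v.1 x)) ⟨_, hv⟩)
    congr 2
    ext x
    have : divergence (fun x => -v.1 x) x = -divergence v.1 x := by
      simp [divergence]
    rw [this]
    ring
  refine le_antisymm (key u) ?_
  simpa using key (fun x => -u x)

theorem deGiorgiVariation_smul_of_nonneg {d : ℕ} {c : ℝ} (hc : 0 ≤ c) (u : Rd d → ℝ) :
    deGiorgiVariation (fun x => c * u x) = ENNReal.ofReal c * deGiorgiVariation u := by
  unfold deGiorgiVariation
  rw [ENNReal.mul_iSup]
  congr 1
  ext v
  simp only [mul_assoc]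
  rw [integral_const_mul, ENNReal.ofReal_mul hc]

theorem deGiorgiVariation_smul {d : ℕ} (c : ℝ) (u : Rd d → ℝ) :
    deGiorgiVariation (fun x => c * u x) = ENNReal.ofReal |c| * deGiorgiVariation u := by
  rcases le_total 0 c with hc | hc
  · rw [abs_of_nonneg hc, deGiorgiVariation_smul_of_nonneg hc]
  · rw [abs_of_nonpos hc, ← deGiorgiVariation_smul_of_nonneg (neg_nonneg.2 hc),
      ← deGiorgiVariation_neg]
    simp only [neg_mul]

theorem deGiorgiVariation_coe_add_le {d : ℕ} (u w : Lp ℝ 1 (volume : Measure (Rd d))) :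
    deGiorgiVariation (u + w : Lp ℝ 1 (volume : Measure (Rd d)))
      ≤ deGiorgiVariation u + deGiorgiVariation w := by
  rw [deGiorgiVariation_congr (Lp.coeFn_add u w)]
  exact deGiorgiVariation_add_le (L1.integrable_coeFn u) (L1.integrable_coeFn w)

theorem deGiorgiVariation_coe_smul {d : ℕ} (c : ℝ) (u : Lp ℝ 1 (volume : Measure (Rd d))) :
    deGiorgiVariation (c • u : Lp ℝ 1 (volume : Measure (Rd d)))
      = ENNReal.ofReal |c| * deGiorgiVariation u := by
  rw [deGiorgiVariation_congr (Lp.coeFn_smul c u)]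
  exact deGiorgiVariation_smul c u

/-- The linear subspace of those `u ∈ L¹(ℝ^d)` that vanish almost everywhere outside `[0,1]^d` and
have finite variation. -/
def bvSubmodule (d : ℕ) : Submodule ℝ (Lp ℝ 1 (volume : Measure (Rd d))) where
  carrier := {u | (∀ᵐ x, x ∉ unitCube d → u x = 0) ∧ deGiorgiVariation u < ∞}
  zero_mem' := by
    have h0 := Lp.coeFn_zero ℝ 1 (volume : Measure (Rd d))
    refine ⟨?_, ?_⟩
    · filter_upwards [h0] with x hx _
      rw [hx, Pi.zero_apply]
    · rw [deGiorgiVariation_congr h0]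
      exact (deGiorgiVariation_zero (d := d)).trans_lt ENNReal.zero_lt_top
  add_mem' := by
    rintro u w ⟨hu, hu'⟩ ⟨hw, hw'⟩
    refine ⟨?_, (deGiorgiVariation_coe_add_le u w).trans_lt (ENNReal.add_lt_top.2 ⟨hu', hw'⟩)⟩
    filter_upwards [Lp.coeFn_add u w, hu, hw] with x h h1 h2 hx
    rw [h, Pi.add_apply, h1 hx, h2 hx, add_zero]
  smul_mem' := by
    rintro c u ⟨hu, hu'⟩
    refine ⟨?_, ?_⟩
    · filter_upwards [Lp.coeFn_smul c u, hu] with x h h1 hx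
      rw [h, Pi.smul_apply, h1 hx, smul_zero]
    · rw [deGiorgiVariation_coe_smul]
      exact ENNReal.mul_lt_top ENNReal.ofReal_lt_top hu'

/-- The space `BV([0,1]^d)`. It is kept apart from the subtype of `bvSubmodule d` because it carries
the norm `‖u‖ = ‖Du‖(ℝ^d)` (below) and not the `L¹` norm. -/
def BV (d : ℕ) : Type := bvSubmodule d

instance (d : ℕ) : AddCommGroup (BV d) := inferInstanceAs (AddCommGroup (bvSubmodule d))

instance (d : ℕ) : Module ℝ (BV d) := inferInstanceAs (Module ℝ (bvSubmodule d))

/-- The inclusion `BV([0,1]^d) ⊆ L¹(ℝ^d)`. -/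
def BV.toL1 {d : ℕ} : BV d →ₗ[ℝ] Lp ℝ 1 (volume : Measure (Rd d)) := (bvSubmodule d).subtype

/-- The map `u ↦ ‖Du‖(ℝ^d)` on `BV([0,1]^d)`. -/
def bvSeminorm (d : ℕ) : Seminorm ℝ (BV d) :=
  Seminorm.of (fun u => (deGiorgiVariation (BV.toL1 u)).toReal)
    (fun u w => by
      have hu : deGiorgiVariation (BV.toL1 u) ≠ ∞ := u.2.2.ne
      have hw : deGiorgiVariation (BV.toL1 w) ≠ ∞ := w.2.2.ne
      rw [map_add, ← ENNReal.toReal_add hu hw]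
      exact ENNReal.toReal_mono (ENNReal.add_ne_top.2 ⟨hu, hw⟩)
        (deGiorgiVariation_coe_add_le _ _))
    (fun c u => by
      rw [map_smul, deGiorgiVariation_coe_smul, ENNReal.toReal_mul,
        ENNReal.toReal_ofReal (abs_nonneg c), Real.norm_eq_abs])

/-- `BV([0,1]^d)` is normed by `‖u‖ = ‖Du‖(ℝ^d)`. (That this vanishes only for `u = 0` when `d ≥ 1`
is not needed in order to speak of the topological dual.) -/
instance (d : ℕ) : SeminormedAddCommGroup (BV d) :=
  (bvSeminorm d).toAddGroupSeminorm.toSeminormedAddCommGroup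

instance (d : ℕ) : NormedSpace ℝ (BV d) where
  norm_smul_le c u := (map_smul_eq_mul (bvSeminorm d) c u).le

theorem BV.norm_def {d : ℕ} (u : BV d) : ‖u‖ = (deGiorgiVariation (BV.toL1 u)).toReal := rfl

/-- The finite `ℝ^d`-valued Borel measure `m` is the distributional gradient `Du` of `u`:
`∫ u div v = - ∫ v · dm` for all `v ∈ C¹_c(ℝ^d; ℝ^d)`. Such an `m` is unique, and by the Riesz
representation theorem it exists when `u` is integrable and of bounded variation. -/
structure IsGradientMeasure {d : ℕ} (u : Rd d → ℝ) (m : VectorMeasure (Rd d) (Rd d)) : Prop where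
  finite : m.variation univ < ∞
  integral_eq : ∀ v : Rd d → Rd d, IsTestField v →
    ∫ x, u x * divergence v x = - m.integral v (innerSL ℝ)

/-- The space `CH([0,1]^d)` of strong charges, a subset of the dual of `BV([0,1]^d)`: the functionals
`div v : u ↦ - ∫_{[0,1]^d} v · dDu` with `v` continuous from `[0,1]^d` to `ℝ^d`. (The values of `v`
outside the cube are irrelevant.) -/
def CH (d : ℕ) : Set (StrongDual ℝ (BV d)) :=
  {ω | ∃ v : Rd d → Rd d, ContinuousOn v (unitCube d) ∧
    ∀ u : BV d, ∃ Du : VectorMeasure (Rd d) (Rd d), IsGradientMeasure (BV.toL1 u) Du ∧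
      ω u = - (Du.restrict (unitCube d)).integral v (innerSL ℝ)}

end

/-! Every test field `w` gives the functional `u ↦ ∫ u div w`, which is continuous for the `L¹` norm
and has dual norm at most `sup ‖w‖`. Both implications rest on approximating `ω` by such functionals
in dual norm. For (1) ⇒ (2), extend `v` continuously with compact support and smooth it. The
resulting test fields approximate `ω` in dual norm (`exists_divFunctional_approx_of_mem_CH`), and
(2) survives limits that are uniform on bounded sets of `BV`. For (2) ⇒ (1), the unit ball of `BV`
is convex and, by Rellich's theorem, compact in `L¹`; condition (2) says that `ω` is `L¹`-continuous
on it. If `ω` has dual norm at most `M`, then for each `u` in the ball the definition of the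
variation yields a field bounded by `M` with `∫ u div w > ω u - ε`. Minimax makes the choice of `w`
independent of `u`, and the symmetry of the ball turns the one-sided bound into a norm bound
(`exists_divFunctional_approx`). The remainder again satisfies (2), so the argument can be repeated
with `M / 2`, `M / 4`, and so on. The fields obtained sum uniformly to a continuous `v` with `ω =
div v`. Strong charges are expressed through `Du`, so its existence is also proved, by weak limits
of difference quotients, as well as the fact that only the cube contributes to its integrals against
test fields. -/

noncomputable section

/-! ### Smoothing and the calculus of test fields -/

/-- Uniform approximation of compactly supported continuous functions by `C¹` ones. -/
theorem exists_contDiff_hasCompactSupport_norm_sub_le {d : ℕ} {E : Type*} [NormedAddCommGroup E]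
    [NormedSpace ℝ E] [CompleteSpace E] {f : Rd d → E} (hf : Continuous f)
    (hc : HasCompactSupport f) {ε : ℝ} (hε : 0 < ε) :
    ∃ g : Rd d → E, ContDiff ℝ 1 g ∧ HasCompactSupport g ∧ ∀ x, ‖g x - f x‖ ≤ ε := by
  obtain ⟨δ, hδ, hfδ⟩ :=
    Metric.uniformContinuous_iff.mp (hc.uniformContinuous_of_continuous hf) ε hε
  obtain ⟨g, hg, hgf⟩ := hf.exists_contDiff_dist_le_of_forall_mem_ball_dist_le hδ
  refine ⟨g, hg.of_le (by exact_mod_cast le_top), ?_, fun x => ?_⟩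
  · refine HasCompactSupport.of_support_subset_isCompact
      (hc.isCompact.cthickening (r := δ)) fun x hx => ?_
    by_contra hx'
    have h0 : ∀ y ∈ Metric.ball x δ, f y = 0 := fun y hy => by
      by_contra hy'
      exact hx' (Metric.mem_cthickening_of_dist_le x y δ _ (subset_tsupport f hy')
        (by rw [dist_comm]; exact (Metric.mem_ball.1 hy).le))
    have hfx : f x = 0 := h0 x (Metric.mem_ball_self hδ)
    -- The error of `g` at `x` is at most the oscillation of `f` on the `δ`-ball, so tolerance `0`
    -- is available where `f` vanishes on that ball.
    have := hgf x 0 (fun y hy => by rw [h0 y hy, hfx, dist_self])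
    rw [hfx, dist_zero_right] at this
    exact hx (norm_le_zero_iff.1 this)
  · rw [← dist_eq_norm]
    exact hgf x ε fun y hy => (hfδ hy).le

theorem divergence_const_smul {d : ℕ} (c : ℝ) (v : Rd d → Rd d) (x : Rd d) :
    divergence (fun y => c • v y) x = c * divergence v x := by
  have : fderiv ℝ (fun y => c • v y) x = c • fderiv ℝ v x :=
    congrFun (fderiv_const_smul_field (f := v) c) x
  simp [divergence, this, Finset.mul_sum]

theorem divergence_add {d : ℕ} {v w : Rd d → Rd d} {x : Rd d} (hv : DifferentiableAt ℝ v x)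
    (hw : DifferentiableAt ℝ w x) :
    divergence (fun y => v y + w y) x = divergence v x + divergence w x := by
  simp [divergence, fderiv_fun_add hv hw, Finset.sum_add_distrib]

theorem divergence_sub {d : ℕ} {v w : Rd d → Rd d} {x : Rd d} (hv : DifferentiableAt ℝ v x)
    (hw : DifferentiableAt ℝ w x) :
    divergence (fun y => v y - w y) x = divergence v x - divergence w x := by
  simp [divergence, fderiv_fun_sub hv hw, Finset.sum_sub_distrib]

/-- Makes directional derivatives accessible to the variation, which only sees divergences. -/
theorem divergence_smul_const {d : ℕ} {g : Rd d → ℝ} {x : Rd d} (hg : DifferentiableAt ℝ g x)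
    (h : Rd d) : divergence (fun y => g y • h) x = fderiv ℝ g x h := by
  have h1 : fderiv ℝ (fun y => g y • h) x = (fderiv ℝ g x).smulRight h :=
    (hg.hasFDerivAt.smul_const h).fderiv
  have h2 : h = ∑ i, h i • EuclideanSpace.single i (1 : ℝ) := by
    ext j
    simp [Finset.sum_apply, Pi.single_apply]
  conv_rhs => rw [h2, map_sum]
  simp [divergence, h1, mul_comm]

theorem IsTestField.differentiable {d : ℕ} {v : Rd d → Rd d} (hv : IsTestField v) :
    Differentiable ℝ v := hv.1.differentiable one_ne_zero

theorem IsTestField.const_smul {d : ℕ} {v : Rd d → Rd d} (hv : IsTestField v) (c : ℝ) :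
    IsTestField (fun x => c • v x) :=
  ⟨hv.1.const_smul c, hv.2.mono fun x hx => by contrapose! hx; simp_all⟩

theorem IsTestField.add {d : ℕ} {v w : Rd d → Rd d} (hv : IsTestField v) (hw : IsTestField w) :
    IsTestField (fun x => v x + w x) := ⟨hv.1.add hw.1, hv.2.add hw.2⟩

theorem IsTestField.sub {d : ℕ} {v w : Rd d → Rd d} (hv : IsTestField v) (hw : IsTestField w) :
    IsTestField (fun x => v x - w x) := ⟨hv.1.sub hw.1, hv.2.sub hw.2⟩

theorem isTestField_zero {d : ℕ} : IsTestField (fun _ : Rd d => (0 : Rd d)) :=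
  ⟨contDiff_const, HasCompactSupport.zero⟩

theorem isTestField_smul_const {d : ℕ} {g : Rd d → ℝ} (hg : ContDiff ℝ 1 g)
    (hc : HasCompactSupport g) (h : Rd d) : IsTestField (fun x => g x • h) :=
  ⟨hg.smul contDiff_const, hc.smul_right⟩

/-- By homogeneity: `c⁻¹ • w` competes in the supremum when `c > 0`, and `c = 0` forces `w = 0`. -/
theorem integral_mul_divergence_le {d : ℕ} {u : Rd d → ℝ} (hu : deGiorgiVariation u ≠ ∞)
    {w : Rd d → Rd d} (hw : IsTestField w) {c : ℝ} (hwc : ∀ x, ‖w x‖ ≤ c) :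
    ∫ x, u x * divergence w x ≤ c * (deGiorgiVariation u).toReal := by
  have h1 : ∀ w : Rd d → Rd d, IsTestField w → (∀ x, ‖w x‖ ≤ 1) →
      ∫ x, u x * divergence w x ≤ (deGiorgiVariation u).toReal := fun w hw hw1 =>
    (ENNReal.ofReal_le_iff_le_toReal hu).1
      (le_iSup (fun v : {v : Rd d → Rd d // IsTestField v ∧ ∀ x, ‖v x‖ ≤ 1} =>
        ENNReal.ofReal (∫ x, u x * divergence v.1 x)) ⟨w, hw, hw1⟩)
  have hc : 0 ≤ c := (norm_nonneg _).trans (hwc 0)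
  rcases hc.eq_or_lt with rfl | hc
  · have : w = fun _ => 0 := funext fun x => norm_le_zero_iff.1 (hwc x)
    simp [this, divergence]
  · have := h1 (fun x => c⁻¹ • w x) (hw.const_smul _) fun x => by
      rw [norm_smul, norm_inv, Real.norm_of_nonneg hc.le, inv_mul_le_iff₀ hc, mul_one]
      exact hwc x
    simp only [divergence_const_smul, mul_left_comm _ c⁻¹] at this
    rwa [integral_const_mul, inv_mul_le_iff₀ hc] at this

theorem abs_integral_mul_divergence_le {d : ℕ} {u : Rd d → ℝ} (hu : deGiorgiVariation u ≠ ∞)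
    {w : Rd d → Rd d} (hw : IsTestField w) {c : ℝ} (hwc : ∀ x, ‖w x‖ ≤ c) :
    |∫ x, u x * divergence w x| ≤ c * (deGiorgiVariation u).toReal := by
  refine abs_le'.2 ⟨integral_mul_divergence_le hu hw hwc, ?_⟩
  have := integral_mul_divergence_le hu (hw.const_smul (-1)) (c := c) (by simpa using hwc)
  simpa only [divergence_const_smul, neg_one_mul, mul_neg, integral_neg] using this

/-! ### Duality for the `L¹` norm and translation estimates -/

/-- The `L¹` norm is computed by testing against compactly supported `C¹` functions. -/
theorem integral_abs_le_of_forall_integral_mul_le {d : ℕ} {f : Rd d → ℝ} (hf : Integrable f)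
    {A : ℝ} (hA : ∀ g : Rd d → ℝ, ContDiff ℝ 1 g → HasCompactSupport g → (∀ x, |g x| ≤ 1) →
      ∫ x, f x * g x ≤ A) : ∫ x, |f x| ≤ A := by
  set I := ∫ x, |f x| with hI
  -- Since `∫ |f| = ∫ f s` with `s` the sign of `f`, replacing `s` by a test function costs at most
  -- its distance to `s` in `L¹(|f| dx)`; this weighted measure is finite and test functions are
  -- dense there.
  set μ : Measure (Rd d) := volume.withDensity (fun x => ‖f x‖ₑ) with hμ
  have hfin : IsFiniteMeasure μ := ⟨by
    simpa [hμ] using hasFiniteIntegral_iff_enorm.1 hf.2⟩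
  set s : Rd d → ℝ := fun x => SignType.sign (f x) with hs
  have hs1 : ∀ x, |s x| ≤ 1 := fun x => by
    rcases lt_trichotomy (f x) 0 with h | h | h <;> simp [hs, h]
  have hsf : ∀ x, f x * s x = |f x| := fun x => self_mul_sign (f x)
  have hsm : AEStronglyMeasurable s volume := by
    have : Measurable (fun x : ℝ => ((SignType.sign x : SignType) : ℝ)) := by
      have : (fun x : ℝ => ((SignType.sign x : SignType) : ℝ)) =
          fun x => if 0 < x then 1 else if x < 0 then -1 else 0 := by
        ext x
        rcases lt_trichotomy x 0 with h | h | h <;> simp [h, not_lt_of_gt]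
      rw [this]
      exact Measurable.ite measurableSet_Ioi measurable_const
        (Measurable.ite measurableSet_Iio measurable_const measurable_const)
    exact (this.comp_aemeasurable hf.1.aemeasurable).aestronglyMeasurable
  have hsμ : MemLp s 1 μ := MemLp.of_bound
    (hsm.mono_ac (withDensity_absolutelyContinuous _ _)) 1 (ae_of_all _ hs1)
  -- The three terms: the hypothesis applied to `g₂ / (1 + ε)`, the `L¹(μ)` distance from `s` to
  -- `g₁`, and the uniform distance from `g₁` to `g₂`.
  have key : ∀ ε : ℝ, 0 < ε → I ≤ A * (1 + ε) + ε + ε * I := by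
    intro ε hε
    obtain ⟨g, hgc, hgε, hg, -⟩ := hsμ.exists_hasCompactSupport_eLpNorm_sub_le ENNReal.one_ne_top
      (ENNReal.ofReal_pos.2 hε).ne'
    -- Truncation to `[-1, 1]` does not increase the distance to `s`, whose values already lie
    -- there.
    set g₁ : Rd d → ℝ := fun x => max (-1) (min 1 (g x)) with hg₁
    have hg₁c : Continuous g₁ := by fun_prop
    have hg₁s : HasCompactSupport g₁ := hgc.mono fun x hx => by
      contrapose! hx
      simp_all
    have hg₁1 : ∀ x, |g₁ x| ≤ 1 := fun x => abs_le.2 ⟨le_max_left _ _,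
      max_le (by norm_num) (min_le_left _ _)⟩
    have hg₁d : ∀ x, |s x - g₁ x| ≤ |s x - g x| := fun x => by
      have := abs_le.1 (hs1 x)
      have h1 : s x = max (-1) (min 1 (s x)) := by
        rw [min_eq_right this.2, max_eq_right this.1]
      calc |s x - g₁ x| = |max (-1) (min 1 (s x)) - max (-1) (min 1 (g x))| := by rw [← h1]
        _ ≤ |min 1 (s x) - min 1 (g x)| := by
          simpa using abs_max_sub_max_le_max (-1) (min 1 (s x)) (-1) (min 1 (g x))
        _ ≤ |s x - g x| := by
          simpa using abs_min_sub_min_le_max 1 (s x) 1 (g x)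
    obtain ⟨g₂, hg₂, hg₂s, hg₂d⟩ := exists_contDiff_hasCompactSupport_norm_sub_le hg₁c hg₁s hε
    have hg₂1 : ∀ x, |g₂ x| ≤ 1 + ε := fun x => by
      have h1 := abs_le.1 (hg₂d x)
      have h2 := abs_le.1 (hg₁1 x)
      exact abs_le.2 ⟨by linarith [h1.1], by linarith [h1.2]⟩
    have hmul : ∀ {k : Rd d → ℝ} (_ : AEStronglyMeasurable k volume) (C : ℝ), (∀ x, |k x| ≤ C) →
        Integrable (fun x => f x * k x) := fun hk C hC => hf.mul_bdd hk (ae_of_all _ hC)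
    have i2 := hmul hg₂.continuous.aestronglyMeasurable _ hg₂1
    have h2 : ∫ x, f x * g₂ x ≤ A * (1 + ε) := by
      have hε1 : 0 < 1 + ε := by linarith
      have := hA (fun x => (1 + ε)⁻¹ * g₂ x) (contDiff_const.mul hg₂) (hg₂s.mul_left) fun x => by
        rw [abs_mul, abs_inv, abs_of_pos hε1, inv_mul_le_iff₀ hε1, mul_one]
        exact hg₂1 x
      simp only [mul_left_comm _ (1 + ε)⁻¹] at this
      rwa [integral_const_mul, inv_mul_le_iff₀ hε1, mul_comm] at this
    have i1 : Integrable (fun x => |f x| * |s x - g₁ x|) :=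
      hf.abs.mul_bdd (hsm.sub hg₁c.aestronglyMeasurable).norm (c := 2) (ae_of_all _ fun x => by
        simp only [norm_abs_eq_norm, Real.norm_eq_abs]
        have := abs_sub (s x) (g₁ x)
        linarith [hs1 x, hg₁1 x])
    have h3 : ∫ x, |f x| * |s x - g₁ x| ≤ ε := by
      rw [eLpNorm_one_eq_lintegral_enorm, lintegral_withDensity_eq_lintegral_mul₀'
        hf.1.enorm (((hsm.sub hg.aestronglyMeasurable).enorm).mono_ac
          (withDensity_absolutelyContinuous _ _))] at hgε
      rw [integral_eq_lintegral_of_nonneg_ae (ae_of_all _ fun x => by positivity) i1.1]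
      refine ENNReal.toReal_le_of_le_ofReal hε.le (le_trans (lintegral_mono fun x => ?_) hgε)
      simp only [Pi.mul_apply, Pi.sub_apply, Real.enorm_eq_ofReal_abs]
      rw [ENNReal.ofReal_mul (abs_nonneg _)]
      gcongr _ * ENNReal.ofReal ?_
      exact hg₁d x
    calc I = ∫ x, (f x * g₂ x + f x * (s x - g₂ x)) := by
          refine integral_congr_ae (ae_of_all _ fun x => ?_)
          simp only [← hsf]; ring
      _ ≤ ∫ x, (f x * g₂ x + (|f x| * |s x - g₁ x| + ε * |f x|)) := by
          refine integral_mono_ae ?_ (i2.add (i1.add (hf.abs.const_mul ε))) (ae_of_all _ fun x => ?_)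
          · exact i2.add (hmul (hsm.sub hg₂.continuous.aestronglyMeasurable) (1 + (1 + ε))
              fun x => (abs_sub _ _).trans (add_le_add (hs1 x) (hg₂1 x)))
          · dsimp only
            gcongr
            calc f x * (s x - g₂ x) ≤ |f x| * |s x - g₂ x| := by
                  rw [← abs_mul]; exact le_abs_self _
              _ ≤ |f x| * (|s x - g₁ x| + ε) := by
                  gcongr
                  have h5 : |g₂ x - g₁ x| ≤ ε := hg₂d x
                  rw [abs_sub_comm] at h5
                  exact (abs_sub_le _ (g₁ x) _).trans (by gcongr)
              _ = _ := by ring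
      _ = (∫ x, f x * g₂ x) + ((∫ x, |f x| * |s x - g₁ x|) + ε * I) := by
          rw [integral_add i2 (by exact i1.add (hf.abs.const_mul ε)),
            integral_add i1 (hf.abs.const_mul ε), integral_const_mul]
      _ ≤ A * (1 + ε) + ε + ε * I := by linarith
  have hlim : Tendsto (fun ε : ℝ => A * (1 + ε) + ε + ε * I) (𝓝[>] 0) (𝓝 A) := by
    have : Continuous (fun ε : ℝ => A * (1 + ε) + ε + ε * I) := by fun_prop
    simpa using (this.tendsto 0).mono_left nhdsWithin_le_nhds
  exact ge_of_tendsto hlim (by filter_upwards [self_mem_nhdsWithin] with ε hε using key ε hε)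

/-- The derivative falls on the smooth factor, so `‖u‖` times a bound for the derivative of `g`
dominates. -/
theorem hasDerivAt_integral_mul_comp_sub_smul {d : ℕ} {u g : Rd d → ℝ} (hui : Integrable u)
    (hg : ContDiff ℝ 1 g) (hgc : HasCompactSupport g) (h : Rd d) (t : ℝ) :
    HasDerivAt (fun t : ℝ => ∫ x, u x * g (x - t • h))
      (∫ x, u x * -(fderiv ℝ g (x - t • h) h)) t := by
  obtain ⟨C, hC⟩ := (hgc.fderiv ℝ).exists_bound_of_continuous
    (hg.continuous_fderiv one_ne_zero)
  obtain ⟨D, hD⟩ := hgc.exists_bound_of_continuous hg.continuous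
  have hgi : ∀ y : Rd d, Integrable (fun x => u x * g (x - y)) := fun y =>
    hui.mul_bdd (hg.continuous.comp (continuous_sub_right y)).aestronglyMeasurable
      (ae_of_all _ fun x => hD _)
  have hdiff : ∀ (x : Rd d) (t : ℝ), HasDerivAt (fun t : ℝ => u x * g (x - t • h))
      (u x * -(fderiv ℝ g (x - t • h) h)) t := fun x t => by
    refine HasDerivAt.const_mul _ ?_
    have h1 : HasDerivAt (fun t : ℝ => x - t • h) (-h) t := by
      simpa using ((hasDerivAt_id t).smul_const h).const_sub x
    have h2 := ((hg.differentiable one_ne_zero (x - t • h)).hasFDerivAt).comp_hasDerivAt t h1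
    rw [map_neg] at h2
    exact h2
  have hcont : ∀ t : ℝ, Continuous fun x => -(fderiv ℝ g (x - t • h) h) := fun t => by
    have := hg.continuous_fderiv one_ne_zero
    fun_prop
  refine (hasDerivAt_integral_of_dominated_loc_of_deriv_le
    (F := fun (t : ℝ) x => u x * g (x - t • h))
    (F' := fun (t : ℝ) x => u x * -(fderiv ℝ g (x - t • h) h)) (bound := fun x => ‖u x‖ * (C * ‖h‖))
    univ_mem (Eventually.of_forall fun t => (hgi _).1) (hgi _)
    (hui.1.mul (hcont t).aestronglyMeasurable) (ae_of_all _ fun x s _ => ?_)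
    (hui.norm.mul_const _) (ae_of_all _ fun x s _ => hdiff x s)).2
  rw [norm_mul, norm_neg]
  gcongr
  exact (ContinuousLinearMap.le_opNorm _ _).trans (by gcongr; exact hC _)

theorem integral_translate_sub_mul {d : ℕ} {u g : Rd d → ℝ} (hui : Integrable u)
    (hg : Continuous g) (hgc : HasCompactSupport g) (h : Rd d) :
    ∫ x, (u (x + h) - u x) * g x = (∫ x, u x * g (x - h)) - ∫ x, u x * g x := by
  obtain ⟨D, hD⟩ := hgc.exists_bound_of_continuous hg
  have h1 : ∫ x, u (x + h) * g x = ∫ x, u x * g (x - h) := by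
    rw [← integral_sub_right_eq_self (fun x => u (x + h) * g x) h]
    simp
  have i1 : Integrable (fun x => u (x + h) * g x) := (hui.comp_add_right h).mul_bdd
    hg.aestronglyMeasurable (ae_of_all _ hD)
  have i2 : Integrable (fun x => u x * g x) := hui.mul_bdd hg.aestronglyMeasurable
    (ae_of_all _ hD)
  simp only [sub_mul]
  rw [integral_sub i1 i2, h1]

/-- Translations move a function of bounded variation by at most `‖h‖ ‖Du‖` in `L¹`. -/
theorem integral_abs_translate_sub_le {d : ℕ} {u : Rd d → ℝ} (hui : Integrable u)
    (hu : deGiorgiVariation u ≠ ∞) (h : Rd d) :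
    ∫ x, |u (x + h) - u x| ≤ ‖h‖ * (deGiorgiVariation u).toReal := by
  refine integral_abs_le_of_forall_integral_mul_le ((hui.comp_add_right h).sub hui)
    fun g hg hgc hg1 => ?_
  -- The derivative in `t` of `∫ u(x) g(x - t h)` is minus the pairing of `u` with the divergence of
  -- the field `g(· - t h) h`, which is bounded by `‖h‖`. The mean value inequality on `[0, 1]`
  -- concludes.
  have hder : ∀ t : ℝ, ‖∫ x, u x * -(fderiv ℝ g (x - t • h) h)‖
      ≤ ‖h‖ * (deGiorgiVariation u).toReal := fun t => by
    have hgt : ContDiff ℝ 1 (fun x => g (x - t • h)) := hg.comp (contDiff_id.sub contDiff_const)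
    have hgtc : HasCompactSupport (fun x => g (x - t • h)) :=
      hgc.comp_homeomorph (Homeomorph.subRight (t • h))
    have := abs_integral_mul_divergence_le hu (isTestField_smul_const hgt hgtc h) (c := ‖h‖)
      fun x => by
        rw [norm_smul]
        exact mul_le_of_le_one_left (norm_nonneg _) (hg1 _)
    rw [Real.norm_eq_abs, ← abs_neg, ← integral_neg]
    simp only [divergence_smul_const (hgt.differentiable one_ne_zero _), fderiv_comp_sub] at this
    simpa using this
  have := norm_image_sub_le_of_norm_deriv_le_segment_01'
    (fun t _ => (hasDerivAt_integral_mul_comp_sub_smul hui hg hgc h t).hasDerivWithinAt)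
    (fun t _ => hder t)
  rw [one_smul, zero_smul] at this
  simp only [sub_zero, Real.norm_eq_abs] at this
  change ∫ x, (u (x + h) - u x) * g x ≤ _
  rw [integral_translate_sub_mul hui hg.continuous hgc]
  exact (le_abs_self _).trans this

/-! ### Poincaré's inequality and Rellich compactness on the cube -/

theorem isClosed_unitCube (d : ℕ) : IsClosed (unitCube d) := by
  have : unitCube d = ⋂ i, ({x | 0 ≤ x i} ∩ {x | x i ≤ 1}) := by
    ext x; simp [unitCube]
  rw [this]
  exact isClosed_iInter fun i => (isClosed_le (by fun_prop) (by fun_prop)).inter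
    (isClosed_le (by fun_prop) (by fun_prop))

theorem isCompact_unitCube (d : ℕ) : IsCompact (unitCube d) := by
  refine Metric.isCompact_of_isClosed_isBounded (isClosed_unitCube d) ?_
  refine (Metric.isBounded_closedBall (x := (0 : Rd d)) (r := √d)).subset fun x hx => ?_
  rw [mem_closedBall_zero_iff, EuclideanSpace.norm_eq]
  refine Real.sqrt_le_sqrt ?_
  calc ∑ i, ‖x i‖ ^ 2 ≤ ∑ _i : Fin d, (1 : ℝ) := Finset.sum_le_sum fun i _ => by
        rw [Real.norm_of_nonneg (hx i).1]
        exact pow_le_one₀ (hx i).1 (hx i).2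
    _ = d := by simp

/-- Poincaré's inequality on the cube. -/
theorem integral_abs_le_deGiorgiVariation {d : ℕ} (hd : 1 ≤ d) {u : Rd d → ℝ} (hui : Integrable u)
    (hu : deGiorgiVariation u ≠ ∞) (h0 : ∀ᵐ x, x ∉ unitCube d → u x = 0) :
    ∫ x, |u x| ≤ (deGiorgiVariation u).toReal := by
  -- A shift of length `2 > 1` along one axis moves the cube off itself, so `u` and its translate
  -- have disjoint supports up to a null set and the translation estimate reads `2 ∫ |u| ≤ 2 ‖Du‖`.
  set h : Rd d := EuclideanSpace.single ⟨0, hd⟩ (2 : ℝ) with hh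
  have hn : ‖h‖ = 2 := by simp [hh]
  have h1 := integral_abs_translate_sub_le hui hu h
  have h0' : ∀ᵐ x, x + h ∉ unitCube d → u (x + h) = 0 :=
    (measurePreserving_add_right volume h).quasiMeasurePreserving.ae h0
  have h2 : ∫ x, |u (x + h) - u x| = ∫ x, (|u (x + h)| + |u x|) := by
    refine integral_congr_ae ?_
    filter_upwards [h0, h0'] with x hx hx'
    by_cases hc : x ∈ unitCube d
    · have : x + h ∉ unitCube d := fun hc' => by
        have a := (hc ⟨0, hd⟩).1
        have b := (hc' ⟨0, hd⟩).2
        simp [hh] at b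
        linarith
      rw [hx' this]; simp
    · rw [hx hc]; simp
  rw [h2, integral_add (hui.comp_add_right h).abs hui.abs,
    integral_add_right_eq_self (fun x => |u x|) h, hn] at h1
  linarith

/-- The mean of `u` over the ball of radius `δ` around a point `c x` close to `x` is close to `u x`
on average. -/
theorem lintegral_enorm_sub_average_le {d : ℕ} {u : Rd d → ℝ} (hum : StronglyMeasurable u)
    (hui : Integrable u) (hu : deGiorgiVariation u ≠ ∞) {δ : ℝ} (hδ : 0 < δ) {S : Set (Rd d)}
    (hS : MeasurableSet S) {c : Rd d → Rd d} (hc : ∀ x ∈ S, dist (c x) x ≤ δ) :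
    ∫⁻ x in S, ‖u x - ⨍ y in Metric.ball (c x) δ, u y‖ₑ
      ≤ ENNReal.ofReal (2 ^ d * (2 * δ)) * deGiorgiVariation u := by
  set B : ℝ≥0∞ := volume (Metric.ball (0 : Rd d) δ) with hB
  have hB0 : B ≠ 0 := (Metric.measure_ball_pos volume _ hδ).ne'
  have hBt : B ≠ ∞ := measure_ball_lt_top.ne
  have hBx : ∀ p : Rd d, volume (Metric.ball p δ) = B := fun p =>
    Measure.addHaar_ball_center volume p δ
  have hB2 : volume (Metric.ball (0 : Rd d) (2 * δ)) = ENNReal.ofReal (2 ^ d) * B := by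
    have := Measure.addHaar_ball_mul_of_pos volume (0 : Rd d) (two_pos : (0 : ℝ) < 2) δ
    simpa using this
  -- The ball of radius `δ` at `c x` lies in the ball of radius `2 * δ` at `x`. The ratio of the
  -- volumes gives `2 ^ d`, and the translations that occur have length below `2 * δ`.
  have step1 : ∀ x ∈ S, ‖u x - ⨍ y in Metric.ball (c x) δ, u y‖ₑ
      ≤ B⁻¹ * ∫⁻ h in Metric.ball (0 : Rd d) (2 * δ), ‖u (x + h) - u x‖ₑ := by
    intro x hx
    have hne : volume.real (Metric.ball (c x) δ) ≠ 0 := by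
      rw [measureReal_def, hBx]; exact (ENNReal.toReal_pos hB0 hBt).ne'
    have h1 : u x - ⨍ y in Metric.ball (c x) δ, u y =
        (volume.real (Metric.ball (c x) δ))⁻¹ * ∫ y in Metric.ball (c x) δ, (u x - u y) := by
      have hci : IntegrableOn (fun _ => u x) (Metric.ball (c x) δ) :=
        integrableOn_const measure_ball_lt_top.ne
      rw [setAverage_eq, smul_eq_mul, integral_sub hci hui.integrableOn,
        setIntegral_const, smul_eq_mul]
      field_simp
    have h2 : ‖(volume.real (Metric.ball (c x) δ))⁻¹‖ₑ = B⁻¹ := by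
      rw [measureReal_def, hBx, enorm_inv (ENNReal.toReal_pos hB0 hBt).ne',
        Real.enorm_of_nonneg ENNReal.toReal_nonneg, ENNReal.ofReal_toReal hBt]
    rw [h1, enorm_mul, h2]
    gcongr
    calc ‖∫ y in Metric.ball (c x) δ, (u x - u y)‖ₑ
        ≤ ∫⁻ y in Metric.ball (c x) δ, ‖u x - u y‖ₑ := enorm_integral_le_lintegral_enorm _
      _ ≤ ∫⁻ y in Metric.ball x (2 * δ), ‖u x - u y‖ₑ := by
          refine lintegral_mono_set (Metric.ball_subset_ball' ?_)
          linarith [hc x hx]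
      _ = ∫⁻ h in Metric.ball (0 : Rd d) (2 * δ), ‖u (x + h) - u x‖ₑ := by
          rw [← lintegral_indicator Metric.isOpen_ball.measurableSet,
            ← lintegral_indicator Metric.isOpen_ball.measurableSet,
            ← lintegral_add_left_eq_self _ x]
          refine lintegral_congr fun h => ?_
          have : x + h ∈ Metric.ball x (2 * δ) ↔ h ∈ Metric.ball (0 : Rd d) (2 * δ) := by
            simp [dist_eq_norm]
          by_cases hh : h ∈ Metric.ball (0 : Rd d) (2 * δ)
          · rw [indicator_of_mem (this.2 hh), indicator_of_mem hh, ← enorm_neg, neg_sub]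
          · rw [indicator_of_notMem (mt this.1 hh), indicator_of_notMem hh]
  have hmeas : Measurable fun p : Rd d × Rd d => ‖u (p.1 + p.2) - u p.1‖ₑ :=
    ((hum.measurable.comp (measurable_fst.add measurable_snd)).sub
      (hum.measurable.comp measurable_fst)).enorm
  have step2 : ∀ h ∈ Metric.ball (0 : Rd d) (2 * δ), ∫⁻ x, ‖u (x + h) - u x‖ₑ
      ≤ ENNReal.ofReal (2 * δ) * deGiorgiVariation u := by
    intro h hh
    have h1 := integral_abs_translate_sub_le hui hu h
    have hi : Integrable fun x => u (x + h) - u x := (hui.comp_add_right h).sub hui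
    rw [← ofReal_integral_norm_eq_lintegral_enorm hi]
    rw [← ENNReal.ofReal_toReal hu, ← ENNReal.ofReal_mul (by positivity)]
    refine ENNReal.ofReal_le_ofReal (h1.trans ?_)
    gcongr
    exact (mem_ball_zero_iff.1 hh).le
  calc ∫⁻ x in S, ‖u x - ⨍ y in Metric.ball (c x) δ, u y‖ₑ
      ≤ ∫⁻ x in S, B⁻¹ * ∫⁻ h in Metric.ball (0 : Rd d) (2 * δ), ‖u (x + h) - u x‖ₑ :=
        setLIntegral_mono' hS step1
    _ ≤ ∫⁻ x, B⁻¹ * ∫⁻ h in Metric.ball (0 : Rd d) (2 * δ), ‖u (x + h) - u x‖ₑ :=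
        setLIntegral_le_lintegral _ _
    _ = B⁻¹ * ∫⁻ h in Metric.ball (0 : Rd d) (2 * δ), ∫⁻ x, ‖u (x + h) - u x‖ₑ := by
        rw [lintegral_const_mul' _ _ (ENNReal.inv_ne_top.2 hB0),
          lintegral_lintegral_swap hmeas.aemeasurable]
    _ ≤ B⁻¹ * ∫⁻ h in Metric.ball (0 : Rd d) (2 * δ),
          ENNReal.ofReal (2 * δ) * deGiorgiVariation u := by
        gcongr B⁻¹ * ?_
        exact setLIntegral_mono' Metric.isOpen_ball.measurableSet step2
    _ = ENNReal.ofReal (2 ^ d * (2 * δ)) * deGiorgiVariation u := by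
        rw [setLIntegral_const, hB2, ENNReal.ofReal_mul (p := 2 ^ d) (by positivity)]
        calc _ = (B⁻¹ * B) * (ENNReal.ofReal (2 ^ d) * ENNReal.ofReal (2 * δ)
              * deGiorgiVariation u) := by ring
          _ = _ := by rw [ENNReal.inv_mul_cancel hB0 hBt, one_mul]

theorem totallyBounded_of_forall_dist_le {α : Type*} [PseudoMetricSpace α] {s : Set α}
    (h : ∀ ε > 0, ∃ K : Set α, TotallyBounded K ∧ ∀ x ∈ s, ∃ y ∈ K, dist x y ≤ ε) :
    TotallyBounded s := by
  rw [Metric.totallyBounded_iff]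
  intro ε hε
  obtain ⟨K, hK, hKs⟩ := h (ε / 2) (half_pos hε)
  obtain ⟨t, ht, htK⟩ := Metric.totallyBounded_iff.1 hK (ε / 2) (half_pos hε)
  refine ⟨t, ht, fun x hx => ?_⟩
  obtain ⟨y, hy, hxy⟩ := hKs x hx
  obtain ⟨z, hz, hyz⟩ := mem_iUnion₂.1 (htK hy)
  refine mem_iUnion₂.2 ⟨z, hz, ?_⟩
  rw [Metric.mem_ball] at hyz ⊢
  linarith [dist_triangle x y z]

/-- Finitely many balls centred on a dense sequence cover `K`; send `x` to the nearest of the first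
centres. Finitely many values mean that averaging around `c x` has finite-dimensional range. -/
theorem exists_simpleFunc_dist_le {d : ℕ} {K : Set (Rd d)} (hK : IsCompact K) {δ : ℝ}
    (hδ : 0 < δ) : ∃ c : SimpleFunc (Rd d) (Rd d), ∀ x ∈ K, dist (c x) x ≤ δ := by
  set e := TopologicalSpace.denseSeq (Rd d)
  obtain ⟨t, ht⟩ := hK.elim_finite_subcover (fun k => Metric.ball (e k) δ)
    (fun k => Metric.isOpen_ball) fun x _ => by
      obtain ⟨k, hk⟩ := (TopologicalSpace.denseRange_denseSeq (Rd d)).exists_dist_lt x hδ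
      exact mem_iUnion.2 ⟨k, hk⟩
  refine ⟨SimpleFunc.nearestPt e (t.sup id), fun x hx => ?_⟩
  obtain ⟨k, hk, hxk⟩ := mem_iUnion₂.1 (ht hx)
  have := SimpleFunc.edist_nearestPt_le e x (Finset.le_sup (f := id) hk)
  rw [id, edist_dist, edist_dist, ENNReal.ofReal_le_ofReal_iff dist_nonneg] at this
  rw [Metric.mem_ball, dist_comm] at hxk
  exact this.trans hxk.le

theorem continuous_integral_mul_of_bounded {α : Type*} [MeasurableSpace α] {μ : Measure α}
    {g : α → ℝ} (hg : AEStronglyMeasurable g μ) {C : ℝ} (hC : ∀ x, |g x| ≤ C) :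
    Continuous fun u : Lp ℝ 1 μ => ∫ x, u x * g x ∂μ := by
  refine (LipschitzWith.of_dist_le_mul (K := C.toNNReal) fun u w => ?_).continuous
  have hi : ∀ u : Lp ℝ 1 μ, Integrable (fun x => u x * g x) μ := fun u =>
    (L1.integrable_coeFn u).mul_bdd hg (ae_of_all _ hC)
  rw [dist_eq_norm, dist_eq_norm, ← integral_sub (hi u) (hi w), L1.norm_eq_integral_norm,
    ← integral_const_mul]
  refine (norm_integral_le_integral_norm _).trans (integral_mono_ae ((hi u).sub (hi w)).norm
    ((L1.integrable_coeFn _).norm.const_mul _) ?_)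
  filter_upwards [Lp.coeFn_sub u w] with x hx
  rw [hx, Pi.sub_apply, ← sub_mul, norm_mul, mul_comm, Real.coe_toNNReal']
  gcongr
  exact (hC x).trans (le_max_left _ _)

theorem IsTestField.continuous_integral_mul_divergence {d : ℕ} {w : Rd d → Rd d}
    (hw : IsTestField w) :
    Continuous fun u : Lp ℝ 1 (volume : Measure (Rd d)) => ∫ x, u x * divergence w x := by
  obtain ⟨C, hC⟩ := hw.hasCompactSupport_divergence.exists_bound_of_continuous
    hw.continuous_divergence
  exact continuous_integral_mul_of_bounded hw.continuous_divergence.aestronglyMeasurable hC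

/-- Vanishing off `S` amounts to the vanishing of the integrals over all measurable parts of `Sᶜ`,
each of which is continuous in `L¹`. -/
theorem isClosed_setOf_ae_eq_zero {α : Type*} [MeasurableSpace α] {μ : Measure α} {S : Set α}
    (hS : MeasurableSet S) : IsClosed {u : Lp ℝ 1 μ | ∀ᵐ x ∂μ, x ∉ S → u x = 0} := by
  have : {u : Lp ℝ 1 μ | ∀ᵐ x ∂μ, x ∉ S → u x = 0} =
      ⋂ (t : Set α) (_ : MeasurableSet t), {u : Lp ℝ 1 μ | ∫ x in t ∩ Sᶜ, u x ∂μ = 0} := by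
    ext u
    simp only [mem_ofPred_eq, mem_iInter]
    refine ⟨fun h t ht => ?_, fun h => ?_⟩
    · refine setIntegral_eq_zero_of_ae_eq_zero ?_
      filter_upwards [h] with x hx hxt using hx hxt.2
    · have := Integrable.ae_eq_zero_of_forall_setIntegral_eq_zero (μ := μ.restrict Sᶜ)
        (L1.integrable_coeFn u).integrableOn fun t ht _ => by
          rw [Measure.restrict_restrict ht]; exact h t ht
      exact (ae_restrict_iff' hS.compl).1 this
  rw [this]
  exact isClosed_iInter fun t => isClosed_iInter fun _ =>
    isClosed_eq (continuous_setIntegral _) continuous_const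

/-- Lower semicontinuity of the variation, as a supremum of `L¹`-continuous functions. -/
theorem isClosed_setOf_deGiorgiVariation_le {d : ℕ} (C : ℝ≥0∞) :
    IsClosed {u : Lp ℝ 1 (volume : Measure (Rd d)) | deGiorgiVariation u ≤ C} := by
  simp only [deGiorgiVariation, iSup_le_iff, ofPred_forall]
  exact isClosed_iInter fun v => isClosed_le
    (ENNReal.continuous_ofReal.comp v.2.1.continuous_integral_mul_divergence) continuous_const

/-- Rellich's theorem for functions of bounded variation on the cube. -/
theorem isCompact_setOf_deGiorgiVariation_le_one {d : ℕ} (hd : 1 ≤ d) :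
    IsCompact {u : Lp ℝ 1 (volume : Measure (Rd d)) |
      (∀ᵐ x, x ∉ unitCube d → u x = 0) ∧ deGiorgiVariation u ≤ 1} := by
  have hcube := (isClosed_unitCube d).measurableSet
  refine TotallyBounded.isCompact_of_isClosed ?_
    ((isClosed_setOf_ae_eq_zero hcube).inter (isClosed_setOf_deGiorgiVariation_le 1))
  refine totallyBounded_of_forall_dist_le fun ε hε => ?_
  -- Chosen so that the averaging error `2 ^ d * (2 * δ)` equals `ε`.
  set δ : ℝ := ε / (2 ^ d * 2) with hδdef
  have hδ : 0 < δ := by positivity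
  obtain ⟨c, hc⟩ := exists_simpleFunc_dist_le (isCompact_unitCube d) hδ
  have hm : ∀ p : c.range, MeasurableSet (c ⁻¹' {p.1} ∩ unitCube d) := fun p =>
    (c.measurableSet_preimage _).inter hcube
  have hf : ∀ p : c.range, volume (c ⁻¹' {p.1} ∩ unitCube d) ≠ ∞ := fun p =>
    ((measure_mono inter_subset_right).trans_lt (isCompact_unitCube d).measure_lt_top).ne
  set M : ℝ := (volume.real (Metric.ball (0 : Rd d) δ))⁻¹ with hM
  -- The step functions on the cells of `c` with coefficients in `[-M, M]` are a compact set.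
  -- Averages over `δ`-balls obey this bound because Poincaré's inequality gives `∫ |u| ≤ 1`.
  refine ⟨(fun a : c.range → ℝ => ∑ p, a p • indicatorConstLp 1 (hm p) (hf p) (1 : ℝ)) ''
    Metric.closedBall 0 M, ?_, ?_⟩
  · exact ((isCompact_closedBall _ _).image (by fun_prop)).totallyBounded
  · rintro u ⟨hu0, hu1⟩
    have hui := L1.integrable_coeFn u
    have hut : deGiorgiVariation u ≠ ∞ := ne_top_of_le_ne_top ENNReal.one_ne_top hu1
    set A : Rd d → ℝ := fun p => ⨍ y in Metric.ball p δ, u y with hA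
    refine ⟨_, ⟨fun p => A p, ?_, rfl⟩, ?_⟩
    · rw [mem_closedBall_zero_iff, pi_norm_le_iff_of_nonneg (by positivity)]
      intro p
      rw [hA]
      simp only
      rw [setAverage_eq, norm_smul, norm_inv, Real.norm_of_nonneg measureReal_nonneg, hM,
        measureReal_def, measureReal_def, Measure.addHaar_ball_center volume p.1 δ]
      refine mul_le_of_le_one_right (by positivity) ?_
      calc ‖∫ y in Metric.ball p.1 δ, u y‖ ≤ ∫ y in Metric.ball p.1 δ, |u y| :=
            norm_integral_le_integral_norm _
        _ ≤ ∫ y, |u y| := setIntegral_le_integral hui.abs (ae_of_all _ fun _ => abs_nonneg _)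
        _ ≤ (deGiorgiVariation u).toReal := integral_abs_le_deGiorgiVariation hd hui hut hu0
        _ ≤ 1 := by simpa using ENNReal.toReal_mono ENNReal.one_ne_top hu1
    · set y : Lp ℝ 1 (volume : Measure (Rd d)) :=
        ∑ p : c.range, A p • indicatorConstLp 1 (hm p) (hf p) (1 : ℝ) with hy
      have hyx : ∀ᵐ x, y x = (unitCube d).indicator (fun x => A (c x)) x := by
        have h1 : ∀ᵐ x, y x = ∑ p : c.range, (A p • indicatorConstLp 1 (hm p) (hf p) (1 : ℝ) :
            Lp ℝ 1 (volume : Measure (Rd d))) x := by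
          filter_upwards [Lp.coeFn_finsetSum Finset.univ (fun p : c.range =>
            (A p • indicatorConstLp 1 (hm p) (hf p) (1 : ℝ) :
              Lp ℝ 1 (volume : Measure (Rd d))))] with x hx
          rw [hy, hx, Finset.sum_apply]
        have h2 : ∀ᵐ x, ∀ p : c.range, (A p • indicatorConstLp 1 (hm p) (hf p) (1 : ℝ) :
            Lp ℝ 1 (volume : Measure (Rd d))) x =
              A p * (c ⁻¹' {p.1} ∩ unitCube d).indicator (fun _ => 1) x := by
          refine ae_all_iff.2 fun p => ?_
          filter_upwards [Lp.coeFn_smul (A p) (indicatorConstLp 1 (hm p) (hf p) (1 : ℝ)),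
            indicatorConstLp_coeFn (p := 1) (hs := hm p) (hμs := hf p) (c := (1 : ℝ))]
            with x hx hx'
          rw [hx, Pi.smul_apply, hx', smul_eq_mul]
        filter_upwards [h1, h2] with x hx hx'
        rw [hx, Finset.sum_congr rfl fun p _ => hx' p]
        by_cases hxc : x ∈ unitCube d
        · rw [indicator_of_mem hxc, Finset.sum_eq_single ⟨c x, c.mem_range_self x⟩]
          · simp [hxc]
          · intro p _ hp
            have : c x ≠ p.1 := fun h => hp (Subtype.ext h.symm)
            simp [this]
          · simp
        · simp [hxc]
      have h3 := lintegral_enorm_sub_average_le (Lp.stronglyMeasurable u) hui hut hδ hcube hc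
      rw [dist_edist, Lp.edist_def, eLpNorm_one_eq_lintegral_enorm]
      refine ENNReal.toReal_le_of_le_ofReal hε.le ?_
      calc ∫⁻ x, ‖(⇑u - ⇑y) x‖ₑ = ∫⁻ x in unitCube d, ‖u x - A (c x)‖ₑ := by
            rw [← lintegral_indicator hcube]
            refine lintegral_congr_ae ?_
            filter_upwards [hyx, hu0] with x hx hx0
            by_cases hxc : x ∈ unitCube d
            · simp [hx, hxc]
            · simp [hx, hxc, hx0 hxc]
        _ ≤ _ := h3
        _ ≤ ENNReal.ofReal (2 ^ d * (2 * δ)) * 1 := by gcongr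
        _ = ENNReal.ofReal ε := by
            rw [mul_one, hδdef]
            congr 1
            field_simp

/-! ### Existence of the gradient measure -/

open scoped CompactlySupported in
/-- Weak-* compactness of bounded sequences of nonnegative `L¹` densities, along an ultrafilter. -/
theorem exists_measure_tendsto_ultrafilter {d : ℕ} (F : Ultrafilter ℕ) {a : ℕ → Rd d → ℝ}
    (hai : ∀ n, Integrable (a n)) (ha0 : ∀ n x, 0 ≤ a n x) {V : ℝ} (hV : ∀ n, ∫ x, a n x ≤ V) :
    ∃ μ : Measure (Rd d), IsFiniteMeasure μ ∧ ∀ g : Rd d → ℝ, Continuous g → HasCompactSupport g →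
      Tendsto (fun n => ∫ x, g x * a n x) F (𝓝 (∫ x, g x ∂μ)) := by
  have hgi : ∀ (g : C_c(Rd d, ℝ)) n, Integrable fun x => g x * a n x := fun g n => by
    obtain ⟨C, hC⟩ := g.hasCompactSupport.exists_bound_of_continuous g.continuous
    exact (hai n).bdd_mul g.continuous.aestronglyMeasurable (ae_of_all _ hC)
  have hbd : ∀ (g : C_c(Rd d, ℝ)) (C : ℝ), 0 ≤ C → (∀ x, g x ≤ C) → ∀ n,
      ∫ x, g x * a n x ≤ C * V := fun g C hC hgC n => by
    calc ∫ x, g x * a n x ≤ ∫ x, C * a n x :=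
          integral_mono (hgi g n) ((hai n).const_mul C) fun x =>
            mul_le_mul_of_nonneg_right (hgC x) (ha0 n x)
      _ = C * ∫ x, a n x := integral_const_mul _ _
      _ ≤ C * V := by gcongr; exact hV n
  -- Bounded real sequences converge along an ultrafilter, so the limit exists for all `g` at once,
  -- without extracting subsequences, and is linear and positive in `g`.
  have hex : ∀ g : C_c(Rd d, ℝ), ∃ L : ℝ, Tendsto (fun n => ∫ x, g x * a n x) F (𝓝 L) := by
    intro g
    obtain ⟨C, hC⟩ := g.hasCompactSupport.exists_bound_of_continuous g.continuous
    have hC0 : 0 ≤ C := (norm_nonneg _).trans (hC 0)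
    obtain ⟨L, -, hL⟩ := (isCompact_Icc (a := -(C * V)) (b := C * V)).ultrafilter_le_nhds
      (F.map fun n => ∫ x, g x * a n x) (by
        rw [Ultrafilter.coe_map, le_principal_iff, mem_map]
        refine univ_mem' fun n => ⟨?_, hbd g C hC0 (fun x => (le_abs_self _).trans (hC x)) n⟩
        have := hbd (-g) C hC0 (fun x => (neg_le_abs _).trans (hC x)) n
        simp only [CompactlySupportedContinuousMap.coe_neg, Pi.neg_apply, neg_mul,
          integral_neg] at this
        linarith)
    exact ⟨L, hL⟩
  choose L hL using hex
  let Λ : C_c(Rd d, ℝ) →ₚ[ℝ] ℝ := PositiveLinearMap.mk₀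
    { toFun := L
      map_add' := fun g h => tendsto_nhds_unique (hL (g + h)) <| by
        refine ((hL g).add (hL h)).congr fun n => ?_
        rw [← integral_add (hgi g n) (hgi h n)]
        simp [add_mul]
      map_smul' := fun c g => tendsto_nhds_unique (hL (c • g)) <| by
        refine ((hL g).const_mul c).congr fun n => ?_
        rw [← integral_const_mul]
        simp [mul_assoc] }
    fun g hg => ge_of_tendsto (hL g) <| Eventually.of_forall fun n =>
      integral_nonneg fun x => mul_nonneg (hg x) (ha0 n x)
  refine ⟨RealRMK.rieszMeasure Λ, ⟨?_⟩, fun g hg hgc => ?_⟩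
  -- The mass is at most `V`: each compact set is tested by a cutoff `f ≤ 1` that equals `1` on it.
  · refine lt_of_le_of_lt ?_ (ENNReal.ofReal_lt_top (r := V))
    rw [isOpen_univ.measure_eq_iSup_isCompact]
    refine iSup_le fun K => iSup_le fun _ => iSup_le fun hK => ?_
    obtain ⟨f, hf1, hfc, -, hf01⟩ :=
      exists_continuousMap_one_of_isCompact_subset_isOpen hK isOpen_univ (subset_univ K)
    let f' : C_c(Rd d, ℝ) := ⟨f, hfc⟩
    refine (RealRMK.rieszMeasure_le_of_eq_one Λ (f := f') (fun x => (hf01 x).1) hK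
      (fun x hx => hf1 hx)).trans (ENNReal.ofReal_le_ofReal ?_)
    refine le_of_tendsto (hL f') (univ_mem' fun n => ?_)
    simpa using hbd f' 1 zero_le_one (fun x => (hf01 x).2) n
  · have h1 := hL ⟨⟨g, hg⟩, hgc⟩
    have h2 := RealRMK.integral_rieszMeasure Λ ⟨⟨g, hg⟩, hgc⟩
    have h3 : ∫ x, g x ∂(RealRMK.rieszMeasure Λ) = L ⟨⟨g, hg⟩, hgc⟩ := h2
    rw [h3]
    exact h1

/-- The vector measure `s ↦ μ s • e`. -/
def MeasureTheory.Measure.smulVectorMeasure {X E : Type*} [MeasurableSpace X]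
    [NormedAddCommGroup E] [NormedSpace ℝ E] (μ : Measure X) [IsFiniteMeasure μ] (e : E) :
    VectorMeasure X E :=
  μ.toSignedMeasure.mapRange (LinearMap.toSpanSingleton ℝ E e).toAddMonoidHom
    (by exact (ContinuousLinearMap.toSpanSingleton ℝ e).continuous)

section smulVectorMeasure

variable {X E : Type*} [MeasurableSpace X] [NormedAddCommGroup E] (μ : Measure X)
  [IsFiniteMeasure μ]

theorem smulVectorMeasure_apply [NormedSpace ℝ E] (e : E) {s : Set X} (hs : MeasurableSet s) :
    μ.smulVectorMeasure e s = μ.real s • e := by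
  rw [← Measure.toSignedMeasure_apply_measurable hs]
  exact VectorMeasure.mapRange_apply _ _

theorem variation_smulVectorMeasure_le [NormedSpace ℝ E] {e : E} (he : ‖e‖ ≤ 1) :
    (μ.smulVectorMeasure e).variation ≤ μ := by
  refine VectorMeasure.variation_le_of_forall_enorm_le fun s hs => ?_
  rw [smulVectorMeasure_apply μ e hs, enorm_smul, measureReal_def,
    Real.enorm_of_nonneg ENNReal.toReal_nonneg, ENNReal.ofReal_toReal (measure_ne_top μ s)]
  refine mul_le_of_le_one_right' ?_
  rw [← ofReal_norm]
  simpa using ENNReal.ofReal_le_ofReal he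

/-- Both sides agree on indicators, and both are continuous in `L¹(μ)`, the left one because the
variation is at most `μ`. -/
theorem integral_smulVectorMeasure [InnerProductSpace ℝ E] [CompleteSpace E] {e : E}
    (he : ‖e‖ ≤ 1) {f : X → E} (hf : Integrable f μ) :
    (μ.smulVectorMeasure e).integral f (innerSL ℝ) = ∫ x, inner ℝ (f x) e ∂μ := by
  have hvar := variation_smulVectorMeasure_le μ he
  have hfin : IsFiniteMeasure (μ.smulVectorMeasure e).variation := isFiniteMeasure_of_le μ hvar
  have hint : ∀ {f : X → E}, Integrable f μ → Integrable f (μ.smulVectorMeasure e).variation :=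
    fun hf => hf.mono_measure hvar
  refine Integrable.induction (fun f => (μ.smulVectorMeasure e).integral f (innerSL ℝ) =
    ∫ x, inner ℝ (f x) e ∂μ) (fun c s hs _ => ?_) (fun f g _ hf hg h1 h2 => ?_) ?_
    (fun f g h _ h1 => ?_) hf
  · have h1 : ∀ x, inner ℝ (s.indicator (fun _ => c) x) e =
        s.indicator (fun _ => (inner ℝ c e : ℝ)) x := fun x => by
      by_cases hx : x ∈ s <;> simp [hx]
    have h2 : IsFiniteMeasure ((μ.smulVectorMeasure e).restrict s).variation :=
      isFiniteMeasure_of_le _ (VectorMeasure.variation_restrict_le.trans Measure.restrict_le_self)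
    simp only [h1]
    rw [VectorMeasure.integral_indicator hs, integral_indicator hs, setIntegral_const,
      VectorMeasure.integral_const, VectorMeasure.restrict_apply _ hs MeasurableSet.univ,
      univ_inter, smulVectorMeasure_apply μ e hs]
    simp only [map_smul, smul_eq_mul]
    rfl
  · simp only [Pi.add_apply, inner_add_left]
    rw [integral_add (hf.inner_const e) (hg.inner_const e), ← h1, ← h2,
      ← VectorMeasure.integral_add (hint hf) (hint hg)]
  · refine isClosed_eq ?_ ?_
    · have : LipschitzWith ‖innerSL ℝ (E := E)‖₊ fun f : Lp E 1 μ =>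
          (μ.smulVectorMeasure e).integral f (innerSL ℝ) := fun f g => ?_
      · exact this.continuous
      refine (VectorMeasure.edist_integral_le_lintegral_edist (hint (L1.integrable_coeFn f))
        (hint (L1.integrable_coeFn g))).trans ?_
      rw [Lp.edist_def, eLpNorm_one_eq_lintegral_enorm, ← enorm_eq_nnnorm]
      simp only [edist_eq_enorm_sub, Pi.sub_apply]
      gcongr
    · have : ∀ f : Lp E 1 μ, ∫ x, inner ℝ (f x) e ∂μ = inner ℝ (∫ x, f x ∂μ) e := fun f => by
        simp only [real_inner_comm e]
        exact integral_inner (L1.integrable_coeFn f) e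
      simp only [this]
      exact continuous_integral.inner continuous_const
  · rw [← VectorMeasure.integral_congr_ae ((Measure.absolutelyContinuous_of_le hvar).ae_le h), h1]
    exact integral_congr_ae (h.mono fun x hx => by simp only [hx])

end smulVectorMeasure

/-- Existence of the distributional gradient. -/
theorem exists_isGradientMeasure {d : ℕ} {u : Rd d → ℝ} (hui : Integrable u)
    (hu : deGiorgiVariation u ≠ ∞) : ∃ Du, IsGradientMeasure u Du := by
  set V := (deGiorgiVariation u).toReal with hV
  let e : Fin d → Rd d := fun i => EuclideanSpace.single i 1
  have he : ∀ i, ‖e i‖ = 1 := fun i => by simp [e]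
  let F : Ultrafilter ℕ := hyperfilter ℕ
  let h : ℕ → ℝ := fun n => ((n : ℝ) + 1)⁻¹
  have hpos : ∀ n, 0 < h n := fun n => by positivity
  have htend : Tendsto h F (𝓝[≠] 0) := by
    refine tendsto_nhdsWithin_iff.2 ⟨?_, univ_mem' fun n => (hpos n).ne'⟩
    have := (tendsto_one_div_add_atTop_nhds_zero_nat (𝕜 := ℝ)).mono_left
      (Nat.hyperfilter_le_atTop)
    simpa [h] using this
  -- Difference quotients are bounded in `L¹` by `V`. Their positive and negative parts get separate
  -- weak limits `P i` and `N i`, as the Riesz theorem used concerns positive functionals.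
  let q : Fin d → ℕ → Rd d → ℝ := fun i n x => (h n)⁻¹ * (u (x + h n • e i) - u x)
  have hqi : ∀ i n, Integrable (q i n) := fun i n =>
    ((hui.comp_add_right _).sub hui).const_mul _
  have hqV : ∀ i n, ∫ x, |q i n x| ≤ V := fun i n => by
    have := integral_abs_translate_sub_le hui hu (h n • e i)
    rw [norm_smul, he, mul_one, Real.norm_of_nonneg (hpos n).le] at this
    simp only [q, abs_mul, abs_inv, abs_of_pos (hpos n)]
    rwa [integral_const_mul, inv_mul_le_iff₀ (hpos n)]
  have hP : ∀ i, ∃ μ : Measure (Rd d), IsFiniteMeasure μ ∧ ∀ g : Rd d → ℝ, Continuous g →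
      HasCompactSupport g → Tendsto (fun n => ∫ x, g x * max (q i n x) 0) F (𝓝 (∫ x, g x ∂μ)) :=
    fun i => exists_measure_tendsto_ultrafilter F (fun n => (hqi i n).pos_part)
      (fun n x => le_max_right _ _) (fun n => (integral_mono (hqi i n).pos_part (hqi i n).abs
        fun x => max_le (le_abs_self _) (abs_nonneg _)).trans (hqV i n))
  have hN : ∀ i, ∃ μ : Measure (Rd d), IsFiniteMeasure μ ∧ ∀ g : Rd d → ℝ, Continuous g →
      HasCompactSupport g → Tendsto (fun n => ∫ x, g x * max (-q i n x) 0) F (𝓝 (∫ x, g x ∂μ)) :=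
    fun i => exists_measure_tendsto_ultrafilter F (fun n => (hqi i n).neg_part)
      (fun n x => le_max_right _ _) (fun n => (integral_mono (hqi i n).neg_part (hqi i n).abs
        fun x => max_le (neg_le_abs _) (abs_nonneg _)).trans (hqV i n))
  choose P hPf hP using hP
  choose N hNf hN using hN
  have hPN : ∀ i (g : Rd d → ℝ), ContDiff ℝ 1 g → HasCompactSupport g →
      (∫ x, g x ∂P i) - ∫ x, g x ∂N i = -∫ x, u x * fderiv ℝ g x (e i) := by
    intro i g hg hgc
    obtain ⟨C, hC⟩ := hgc.exists_bound_of_continuous hg.continuous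
    have hder := hasDerivAt_iff_tendsto_slope_zero.1
      (hasDerivAt_integral_mul_comp_sub_smul hui hg hgc (e i) 0)
    have h1 := hder.comp htend
    simp only [zero_smul, sub_zero, mul_neg, integral_neg, zero_add] at h1
    refine tendsto_nhds_unique ((hP i g hg.continuous hgc).sub (hN i g hg.continuous hgc))
      (h1.congr fun n => ?_)
    have i1 : Integrable fun x => g x * max (q i n x) 0 := (hqi i n).pos_part.bdd_mul
      hg.continuous.aestronglyMeasurable (ae_of_all _ hC)
    have i2 : Integrable fun x => g x * max (-q i n x) 0 := (hqi i n).neg_part.bdd_mul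
      hg.continuous.aestronglyMeasurable (ae_of_all _ hC)
    rw [← integral_sub i1 i2, Function.comp_apply, ← integral_translate_sub_mul hui hg.continuous
      hgc, smul_eq_mul, ← integral_const_mul]
    refine integral_congr_ae (ae_of_all _ fun x => ?_)
    simp only
    have : max (q i n x) 0 - max (-q i n x) 0 = q i n x := by
      rcases le_total (q i n x) 0 with hq | hq
      · rw [max_eq_right hq, max_eq_left (neg_nonneg.2 hq)]; ring
      · rw [max_eq_left hq, max_eq_right (neg_nonpos.2 hq)]; ring
    rw [← mul_sub, this]
    ring
  -- `P i - N i` is the `i`-th distributional partial derivative of `u`, so the sum of the `ν i` is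
  -- the gradient.
  let ν : Fin d → VectorMeasure (Rd d) (Rd d) := fun i =>
    (P i).smulVectorMeasure (e i) - (N i).smulVectorMeasure (e i)
  have hνv : ∀ i, (ν i).variation ≤ P i + N i := fun i =>
    VectorMeasure.variation_sub_le.trans (add_le_add
      (variation_smulVectorMeasure_le _ (he i).le) (variation_smulVectorMeasure_le _ (he i).le))
  refine ⟨∑ i, ν i, ?_, fun w hw => ?_⟩
  · have h1 : (∑ i, ν i).variation ≤ ∑ i, (P i + N i) :=
      (VectorMeasure.variation_finsetSum_le _ _).trans (Finset.sum_le_sum fun i _ => hνv i)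
    exact (h1 univ).trans_lt (measure_lt_top _ _)
  · have hwi : ∀ (μ : Measure (Rd d)) [IsFiniteMeasure μ], Integrable w μ := fun μ _ =>
      hw.1.continuous.integrable_of_hasCompactSupport hw.2
    have hPi : ∀ i, ((P i).smulVectorMeasure (e i)).Integrable w := fun i =>
      (hwi (P i)).mono_measure (variation_smulVectorMeasure_le _ (he i).le)
    have hNi : ∀ i, ((N i).smulVectorMeasure (e i)).Integrable w := fun i =>
      (hwi (N i)).mono_measure (variation_smulVectorMeasure_le _ (he i).le)
    have hcomp : ∀ i, ContDiff ℝ 1 fun x => w x i := fun i =>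
      (EuclideanSpace.proj (𝕜 := ℝ) i).contDiff.comp hw.1
    have hcompc : ∀ i, HasCompactSupport fun x => w x i := fun i =>
      hw.2.comp_left (g := fun y : Rd d => y i) rfl
    have hfd : ∀ i x, fderiv ℝ (fun y => w y i) x (e i) = fderiv ℝ w x (e i) i := fun i x => by
      have := ((EuclideanSpace.proj (𝕜 := ℝ) i).hasFDerivAt.comp x
        (hw.differentiable x).hasFDerivAt).fderiv
      exact congrArg (fun L : Rd d →L[ℝ] ℝ => L (e i)) this
    have hei : ∀ i (y : Rd d), inner ℝ y (e i) = y i := fun i y => by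
      simp [e, EuclideanSpace.inner_single_right]
    rw [VectorMeasure.integral_finsetSum_vectorMeasure fun i _ => (hPi i).sub_vectorMeasure (hNi i)]
    have h1 : ∀ i, (ν i).integral w (innerSL ℝ) = -∫ x, u x * fderiv ℝ w x (e i) i := fun i => by
      rw [VectorMeasure.integral_sub_vectorMeasure (hPi i) (hNi i),
        integral_smulVectorMeasure _ (he i).le (hwi _),
        integral_smulVectorMeasure _ (he i).le (hwi _)]
      simp only [hei]
      rw [hPN i _ (hcomp i) (hcompc i)]
      simp only [hfd]
    have h2 : ∀ i, Integrable fun x => u x * fderiv ℝ w x (e i) i := fun i => by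
      obtain ⟨C, hC⟩ := ((hcompc i).fderiv ℝ).exists_bound_of_continuous
        ((hcomp i).continuous_fderiv one_ne_zero)
      have hc := (hcomp i).continuous_fderiv one_ne_zero
      simp only [← hfd]
      refine hui.mul_bdd (c := C) (by fun_prop) (ae_of_all _ fun x => ?_)
      refine (ContinuousLinearMap.le_opNorm _ _).trans ?_
      rw [he, mul_one]
      exact hC x
    rw [Finset.sum_congr rfl fun i _ => h1 i, Finset.sum_neg_distrib, neg_neg,
      ← integral_finsetSum _ fun i _ => h2 i]
    simp only [divergence, Finset.mul_sum, e]

/-! ### Concentration of the gradient on the cube -/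

/-- `φ` is `1` near `K`, not merely on it, so that multiplying by `φ` changes no derivative at
points of `K`, including boundary points. -/
theorem exists_contDiff_cutoff {d : ℕ} {K : Set (Rd d)} (hK : IsClosed K) {δ : ℝ} (hδ : 0 < δ) :
    ∃ φ : Rd d → ℝ, ContDiff ℝ 1 φ ∧ (∀ x ∉ Metric.thickening δ K, φ x = 0) ∧
      (∀ x ∈ K, ∀ᶠ y in 𝓝 x, φ y = 1) ∧ ∀ x, φ x ∈ Icc (0 : ℝ) 1 := by
  obtain ⟨φ, h1, h2, h3⟩ := exists_contMDiffMap_zero_one_nhds_of_isClosed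
    (modelWithCornersSelf ℝ (Rd d)) (n := 1)
    (Metric.isOpen_thickening (δ := δ) (E := K)).isClosed_compl hK
    (disjoint_compl_left_iff_subset.2 (Metric.self_subset_thickening hδ _))
  exact ⟨φ, φ.contMDiff.contDiff, fun x hx => h1.self_of_nhdsSet x hx,
    eventually_nhdsSet_iff_forall.1 h2, h3⟩

theorem exists_notMem_thickening {d : ℕ} {K : Set (Rd d)} (hK : IsClosed K) {x : Rd d}
    (hx : x ∉ K) : ∃ δ > 0, x ∉ Metric.thickening δ K := by
  obtain ⟨δ, hδ, h⟩ := Metric.isOpen_iff.1 hK.isOpen_compl x hx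
  refine ⟨δ, hδ, fun hxδ => ?_⟩
  obtain ⟨z, hz, hxz⟩ := Metric.mem_thickening_iff.1 hxδ
  exact h (Metric.mem_ball'.2 hxz) hz

/-- The gradient measure of a function vanishing outside the cube is concentrated on the cube. -/
theorem IsGradientMeasure.integral_restrict_unitCube {d : ℕ} {u : Rd d → ℝ}
    {Du : VectorMeasure (Rd d) (Rd d)} (hDu : IsGradientMeasure u Du)
    (h0 : ∀ᵐ x, x ∉ unitCube d → u x = 0) {w : Rd d → Rd d} (hw : IsTestField w) :
    (Du.restrict (unitCube d)).integral w (innerSL ℝ) = -∫ x, u x * divergence w x := by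
  have hfin : IsFiniteMeasure Du.variation := ⟨hDu.finite⟩
  have hcut := fun k : ℕ => exists_contDiff_cutoff (isClosed_unitCube d) (δ := ((k : ℝ) + 1)⁻¹)
    (by positivity)
  choose φ hφ hφ0 hφ1 hφI using hcut
  obtain ⟨C, hC⟩ := hw.2.exists_bound_of_continuous hw.1.continuous
  -- The cutoffs decrease their supports to the cube, so dominated convergence applies; yet by
  -- `hconst` the integrals do not depend on `k`, since `u` vanishes off the cube and `φ k` is `1`
  -- near it.
  have hlim : Tendsto (fun k => Du.integral (fun x => φ k x • w x) (innerSL ℝ)) atTop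
      (𝓝 (Du.integral ((unitCube d).indicator w) (innerSL ℝ))) := by
    refine VectorMeasure.tendsto_integral_of_dominated_convergence (fun _ => C)
      (fun k => ((hφ k).continuous.smul hw.1.continuous).aestronglyMeasurable)
      (integrable_const _) (fun k => ae_of_all _ fun x => ?_) (ae_of_all _ fun x => ?_)
    · rw [norm_smul, Real.norm_of_nonneg (hφI k x).1]
      exact (mul_le_of_le_one_left (norm_nonneg _) (hφI k x).2).trans (hC x)
    · refine tendsto_const_nhds.congr' ?_
      by_cases hx : x ∈ unitCube d
      · refine Eventually.of_forall fun k => ?_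
        simp [hx, (hφ1 k x hx).self_of_nhds]
      · obtain ⟨δ, hδ, hxδ⟩ := exists_notMem_thickening (isClosed_unitCube d) hx
        have h1 := (tendsto_order.1 (tendsto_one_div_add_atTop_nhds_zero_nat (𝕜 := ℝ))).2 δ hδ
        filter_upwards [h1] with k hk
        rw [one_div] at hk
        rw [hφ0 k x fun hx' => hxδ (Metric.thickening_mono hk.le _ hx')]
        simp [hx]
  rw [VectorMeasure.integral_indicator (isClosed_unitCube d).measurableSet] at hlim
  have hconst : ∀ k, Du.integral (fun x => φ k x • w x) (innerSL ℝ) =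
      -∫ x, u x * divergence w x := fun k => by
    have htest : IsTestField fun x => φ k x • w x := ⟨(hφ k).smul hw.1,
      hw.2.mono fun x hx hx0 => hx (by simp only [hx0, smul_zero])⟩
    rw [eq_neg_iff_add_eq_zero, add_comm, ← eq_neg_iff_add_eq_zero, ← hDu.integral_eq _ htest]
    refine integral_congr_ae ?_
    filter_upwards [h0] with x hx
    by_cases hxc : x ∈ unitCube d
    · have hev : w =ᶠ[𝓝 x] fun y => φ k y • w y := by
        filter_upwards [hφ1 k x hxc] with y hy
        rw [hy, one_smul]
      simp only [divergence, hev.fderiv_eq]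
    · rw [hx hxc, zero_mul, zero_mul]
  simp only [hconst] at hlim
  exact tendsto_nhds_unique hlim tendsto_const_nhds

/-! ### Functionals given by test fields -/

theorem BV.ae_eq_zero {d : ℕ} (u : BV d) : ∀ᵐ x, x ∉ unitCube d → BV.toL1 u x = 0 := u.2.1

theorem BV.deGiorgiVariation_ne_top {d : ℕ} (u : BV d) : deGiorgiVariation (BV.toL1 u) ≠ ∞ :=
  u.2.2.ne

theorem BV.integrable {d : ℕ} (u : BV d) : Integrable (BV.toL1 u) := L1.integrable_coeFn _

/-- The functional `u ↦ ∫ u div w` for a test field `w`. -/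
def divFunctional {d : ℕ} (w : Rd d → Rd d) (hw : IsTestField w) : BV d →ₗ[ℝ] ℝ where
  toFun u := ∫ x, BV.toL1 u x * divergence w x
  map_add' u v := by
    rw [← integral_add (hw.integrable_mul_divergence u.integrable)
      (hw.integrable_mul_divergence v.integrable), map_add]
    refine integral_congr_ae ?_
    filter_upwards [Lp.coeFn_add (BV.toL1 u) (BV.toL1 v)] with x hx
    rw [hx, Pi.add_apply, add_mul]
  map_smul' c u := by
    rw [RingHom.id_apply, smul_eq_mul, ← integral_const_mul, map_smul]
    refine integral_congr_ae ?_
    filter_upwards [Lp.coeFn_smul c (BV.toL1 u)] with x hx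
    rw [hx, Pi.smul_apply, smul_eq_mul, mul_assoc]

theorem divFunctional_apply {d : ℕ} {w : Rd d → Rd d} (hw : IsTestField w) (u : BV d) :
    divFunctional w hw u = ∫ x, BV.toL1 u x * divergence w x := rfl

theorem divFunctional_sub {d : ℕ} {w w' : Rd d → Rd d} (hw : IsTestField w)
    (hw' : IsTestField w') (u : BV d) :
    divFunctional _ (hw.sub hw') u = divFunctional w hw u - divFunctional w' hw' u := by
  simp only [divFunctional_apply]
  rw [← integral_sub (hw.integrable_mul_divergence u.integrable)
    (hw'.integrable_mul_divergence u.integrable)]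
  simp only [divergence_sub (hw.differentiable _) (hw'.differentiable _), mul_sub]

theorem divFunctional_add {d : ℕ} {w w' : Rd d → Rd d} (hw : IsTestField w)
    (hw' : IsTestField w') (u : BV d) :
    divFunctional _ (hw.add hw') u = divFunctional w hw u + divFunctional w' hw' u := by
  simp only [divFunctional_apply]
  rw [← integral_add (hw.integrable_mul_divergence u.integrable)
    (hw'.integrable_mul_divergence u.integrable)]
  simp only [divergence_add (hw.differentiable _) (hw'.differentiable _), mul_add]

theorem divFunctional_const_smul {d : ℕ} {w : Rd d → Rd d} (hw : IsTestField w) (c : ℝ)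
    (u : BV d) : divFunctional _ (hw.const_smul c) u = c * divFunctional w hw u := by
  simp only [divFunctional_apply, divergence_const_smul, mul_left_comm _ c]
  exact integral_const_mul _ _

theorem abs_divFunctional_le {d : ℕ} {w : Rd d → Rd d} (hw : IsTestField w) {c : ℝ}
    (hc : ∀ x, ‖w x‖ ≤ c) (u : BV d) : |divFunctional w hw u| ≤ c * ‖u‖ :=
  abs_integral_mul_divergence_le u.deGiorgiVariation_ne_top hw hc

/-! ### Strong charges are sequentially continuous -/

/-- Convergence of `ω` along `L¹`-convergent sequences bounded in `BV`. -/
def SeqContinuousOnBounded {d : ℕ} (ω : BV d → ℝ) : Prop :=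
  ∀ (u : ℕ → BV d) (u₀ : BV d),
    Tendsto (fun n => BV.toL1 (u n)) atTop (𝓝 (BV.toL1 u₀)) →
    (∃ C : ℝ, ∀ n, ‖u n‖ ≤ C) → Tendsto (fun n => ω (u n)) atTop (𝓝 (ω u₀))

theorem seqContinuousOnBounded_divFunctional {d : ℕ} {w : Rd d → Rd d} (hw : IsTestField w) :
    SeqContinuousOnBounded (divFunctional w hw) := fun _ _ hu _ =>
  (hw.continuous_integral_mul_divergence.tendsto _).comp hu

/-- Approximation in dual norm is uniform on bounded sets, so continuity passes to the limit. -/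
theorem seqContinuousOnBounded_of_approx {d : ℕ} {ω : BV d → ℝ}
    (h : ∀ ε > 0, ∃ (w : Rd d → Rd d) (hw : IsTestField w),
      ∀ u, |ω u - divFunctional w hw u| ≤ ε * ‖u‖) : SeqContinuousOnBounded ω := by
  rintro u u₀ hu ⟨C, hC⟩
  have hC0 : 0 ≤ C := (norm_nonneg _).trans (hC 0)
  rw [Metric.tendsto_atTop]
  intro ε hε
  -- The errors at `u n` and at `u₀` then add up to at most `ε / 2`; the `1` keeps the denominator
  -- positive.
  set η := ε / (2 * (C + ‖u₀‖ + 1)) with hη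
  have hpos : 0 < C + ‖u₀‖ + 1 := by positivity
  have hη0 : 0 < η := by positivity
  have hηe : η * (C + ‖u₀‖ + 1) = ε / 2 := by rw [hη]; field_simp
  obtain ⟨w, hw, hωw⟩ := h η hη0
  obtain ⟨N, hN⟩ := Metric.tendsto_atTop.1
    (seqContinuousOnBounded_divFunctional hw u u₀ hu ⟨C, hC⟩) (ε / 2) (half_pos hε)
  refine ⟨N, fun n hn => ?_⟩
  have h1 := abs_le.1 (hωw (u n))
  have h2 := abs_le.1 (hωw u₀)
  have h3 := abs_lt.1 (hN n hn)
  have h4 : η * ‖u n‖ ≤ η * C := by gcongr; exact hC n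
  rw [Real.dist_eq, abs_lt]
  constructor <;> nlinarith [h1.1, h1.2, h2.1, h2.2, h3.1, h3.2]

/-- Tietze extension, multiplied by a cutoff. -/
theorem exists_continuous_hasCompactSupport_eqOn {d : ℕ} {K : Set (Rd d)} (hK : IsCompact K)
    {v : Rd d → Rd d} (hv : ContinuousOn v K) :
    ∃ f : Rd d → Rd d, Continuous f ∧ HasCompactSupport f ∧ EqOn f v K := by
  obtain ⟨g, hg⟩ := ContinuousMap.exists_restrict_eq hK.isClosed ⟨K.domRestrict v, hv.domRestrict⟩
  obtain ⟨φ, hφ, hφ0, hφ1, -⟩ := exists_contDiff_cutoff hK.isClosed one_pos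
  refine ⟨fun x => φ x • g x, hφ.continuous.smul g.continuous, ?_, fun x hx => ?_⟩
  · refine HasCompactSupport.of_support_subset_isCompact (hK.cthickening (r := 1))
      fun x hx => Metric.thickening_subset_cthickening _ _ ?_
    by_contra hx'
    exact hx (by simp only [hφ0 x hx', zero_smul])
  · have h1 : g x = v x := congrArg (fun f : C(K, Rd d) => f ⟨x, hx⟩) hg
    simp only [(hφ1 x hx).self_of_nhds, one_smul, h1]

theorem exists_divFunctional_approx_of_mem_CH {d : ℕ} {ω : StrongDual ℝ (BV d)} (hω : ω ∈ CH d)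
    {ε : ℝ} (hε : 0 < ε) : ∃ (w : Rd d → Rd d) (hw : IsTestField w),
      ∀ u, |ω u - divFunctional w hw u| ≤ ε * ‖u‖ := by
  obtain ⟨v, hv, hωv⟩ := hω
  obtain ⟨f, hf, hfc, hfv⟩ := exists_continuous_hasCompactSupport_eqOn (isCompact_unitCube d) hv
  obtain ⟨w, hw1, hw2, hwf⟩ := exists_contDiff_hasCompactSupport_norm_sub_le hf hfc (half_pos hε)
  have hw : IsTestField w := ⟨hw1, hw2⟩
  refine ⟨w, hw, fun u => ?_⟩
  obtain ⟨Du, hDu, hωu⟩ := hωv u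
  have hfin : IsFiniteMeasure Du.variation := ⟨hDu.finite⟩
  have hvar : (Du.restrict (unitCube d)).variation ≤ Du.variation :=
    VectorMeasure.variation_restrict_le.trans Measure.restrict_le_self
  have hfin' : IsFiniteMeasure (Du.restrict (unitCube d)).variation := isFiniteMeasure_of_le _ hvar
  set c := ‖innerSL ℝ (E := Rd d)‖ * (Du.restrict (unitCube d)).variation.real univ with hc
  have hc0 : 0 ≤ c := by positivity
  -- Comparing `ω` with a test field through `Du` costs a constant `c` depending on the total
  -- variation of `Du`, which is never compared with `‖u‖`. An auxiliary field `w'`, `η`-close to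
  -- `f`, makes this cost `η * c`, which vanishes as `η → 0`, while `w' - w` is estimated directly
  -- by the definition of `‖u‖`.
  have key : ∀ η > 0, |ω u - divFunctional w hw u| ≤ ε / 2 * ‖u‖ + η * (c + ‖u‖) := by
    intro η hη
    obtain ⟨w', hw1', hw2', hwf'⟩ := exists_contDiff_hasCompactSupport_norm_sub_le hf hfc hη
    have hw' : IsTestField w' := ⟨hw1', hw2'⟩
    have h1 : |divFunctional w' hw' u - divFunctional w hw u| ≤ (η + ε / 2) * ‖u‖ := by
      rw [← divFunctional_sub]
      refine abs_divFunctional_le _ (fun x => ?_) u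
      calc ‖w' x - w x‖ = ‖(w' x - f x) - (w x - f x)‖ := by congr 1; abel
        _ ≤ η + ε / 2 := (norm_sub_le _ _).trans (add_le_add (hwf' x) (hwf x))
    have h2 : |ω u - divFunctional w' hw' u| ≤ η * c := by
      have e1 : divFunctional w' hw' u =
          -(Du.restrict (unitCube d)).integral w' (innerSL ℝ) := by
        rw [hDu.integral_restrict_unitCube u.ae_eq_zero hw', neg_neg, divFunctional_apply]
      have e2 : (Du.restrict (unitCube d)).integral v (innerSL ℝ) =
          (Du.restrict (unitCube d)).integral f (innerSL ℝ) :=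
        VectorMeasure.setIntegral_congr_fun fun x hx => (hfv hx).symm
      have i1 : (Du.restrict (unitCube d)).Integrable w' :=
        hw1'.continuous.integrable_of_hasCompactSupport hw2'
      have i2 : (Du.restrict (unitCube d)).Integrable f :=
        hf.integrable_of_hasCompactSupport hfc
      rw [e1, hωu, e2, neg_sub_neg, ← VectorMeasure.integral_sub i1 i2, ← Real.norm_eq_abs]
      refine (VectorMeasure.norm_integral_le_of_norm_le_const (ae_of_all _ hwf')).trans_eq ?_
      rw [hc, mul_assoc]
    calc |ω u - divFunctional w hw u| ≤ |ω u - divFunctional w' hw' u| +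
          |divFunctional w' hw' u - divFunctional w hw u| := abs_sub_le _ _ _
      _ ≤ η * c + (η + ε / 2) * ‖u‖ := add_le_add h2 h1
      _ = _ := by ring
  have hlim : Tendsto (fun η : ℝ => ε / 2 * ‖u‖ + η * (c + ‖u‖)) (𝓝[>] 0) (𝓝 (ε / 2 * ‖u‖)) := by
    have : Continuous (fun η : ℝ => ε / 2 * ‖u‖ + η * (c + ‖u‖)) := by fun_prop
    simpa using (this.tendsto 0).mono_left nhdsWithin_le_nhds
  have h1 := ge_of_tendsto hlim (by filter_upwards [self_mem_nhdsWithin] with η hη using key η hη)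
  have h2 : 0 ≤ ε * ‖u‖ := by positivity
  linarith

/-! ### Minimax approximation of sequentially continuous functionals -/

/-- A near-maximiser for the variation, scaled by `M`. The zero field settles `M * ‖u‖ < ε`, which
includes `M = 0`. -/
theorem exists_lt_divFunctional {d : ℕ} (u : BV d) {M : ℝ} (hM : 0 ≤ M) {ε : ℝ} (hε : 0 < ε) :
    ∃ (w : Rd d → Rd d) (hw : IsTestField w), (∀ x, ‖w x‖ ≤ M) ∧
      M * ‖u‖ - ε < divFunctional w hw u := by
  have hzero : divFunctional _ isTestField_zero u = 0 := by
    simp [divFunctional_apply, divergence]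
  by_cases h : M * ‖u‖ - ε < 0
  · exact ⟨_, isTestField_zero, fun x => by simpa using hM, by rw [hzero]; exact h⟩
  rw [not_lt] at h
  have hMpos : 0 < M := hM.lt_of_ne fun h0 => by rw [← h0] at h; linarith
  have h1 : ENNReal.ofReal (‖u‖ - ε / M) < deGiorgiVariation (BV.toL1 u) := by
    rw [← ENNReal.ofReal_toReal u.deGiorgiVariation_ne_top, ← BV.norm_def]
    have h3 : 0 < ε / M := by positivity
    have h4 : 0 < M * ‖u‖ := by linarith
    refine (ENNReal.ofReal_lt_ofReal_iff (pos_of_mul_pos_right h4 hM)).2 ?_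
    linarith
  obtain ⟨⟨v, hv, hv1⟩, hlt⟩ := lt_iSup_iff.1 h1
  have h2 := (ENNReal.ofReal_lt_ofReal_iff_of_nonneg (by
    rw [sub_nonneg, div_le_iff₀ hMpos]; linarith)).1 hlt
  refine ⟨_, hv.const_smul M, fun x => ?_, ?_⟩
  · rw [norm_smul, Real.norm_of_nonneg hM]
    exact mul_le_of_le_one_right hM (hv1 x)
  · rw [divFunctional_const_smul hv]
    calc M * ‖u‖ - ε = M * (‖u‖ - ε / M) := by field_simp
      _ < _ := by gcongr; exact h2

/-- Sion's minimax theorem for linear functionals on a compact convex set. -/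
theorem exists_forall_lt_of_forall_exists_lt {E : Type*} [AddCommGroup E] [Module ℝ E]
    [TopologicalSpace E] [IsTopologicalAddGroup E] [ContinuousSMul ℝ E] {X : Set E}
    (hXne : X.Nonempty) (hXc : IsCompact X) (hX : Convex ℝ X) {Y : Set (E →ₗ[ℝ] ℝ)}
    (hY : Convex ℝ Y) (hYc : ∀ y ∈ Y, ContinuousOn y X) {t : ℝ}
    (hex : ∀ u ∈ X, ∃ y ∈ Y, t < y u) : ∃ y ∈ Y, ∀ u ∈ X, t < y u := by
  choose! y hyY hy using hex
  -- By compactness finitely many `y u` exceed `t` somewhere at each point of `X`; Sion's theorem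
  -- replaces them by a single element of `Y`.
  obtain ⟨s, hsX, hs⟩ := hXc.elim_nhdsWithin_subcover (fun u => {u' | t < y u u'})
    fun u hu => (hYc (y u) (hyY u hu) u hu).eventually (lt_mem_nhds (hy u hu))
  -- Viewing functionals in the product space `E → ℝ` provides a topology on the side of `Y` for
  -- which evaluation at `u` is continuous.
  let L : (E →ₗ[ℝ] ℝ) →ₗ[ℝ] (E → ℝ) := LinearMap.ltoFun ℝ E ℝ ℝ
  obtain ⟨_, ⟨z, hz, rfl⟩, hz0⟩ := Sion.exists_lt_iInf_of_lt_iInf_of_finite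
    (X := X) (Y := L '' Y) (f := fun u y => y u) hXne hXc
    (by
      rintro _ ⟨y, hy, rfl⟩
      exact (hYc y hy).lowerSemicontinuousOn)
    (by
      rintro _ ⟨y, hy, rfl⟩
      exact (y.convexOn hX).quasiconvexOn)
    (hY.linear_image L)
    (fun u _ => (continuous_apply u).upperSemicontinuous.upperSemicontinuousOn _)
    (fun u _ => ((LinearMap.proj u : (E → ℝ) →ₗ[ℝ] ℝ).concaveOn (hY.linear_image L)).quasiconcaveOn)
    hX (s.finite_toSet.image fun u => L (y u)) (by
      rintro _ ⟨u, hu, rfl⟩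
      exact mem_image_of_mem _ (hyY u (hsX u hu))) (t := t) (fun u hu => by
      obtain ⟨u', hu', h⟩ := mem_iUnion₂.1 (hs hu)
      exact ⟨_, mem_image_of_mem _ hu', h⟩)
  exact ⟨z, hz, hz0⟩

/-- The minimax step: a sequentially continuous functional of norm at most `M` is close, in norm,
to the divergence of a test field bounded by `M`. -/
theorem exists_divFunctional_approx {d : ℕ} (hd : 1 ≤ d) {ω : BV d →ₗ[ℝ] ℝ}
    (hω : SeqContinuousOnBounded ω) {M : ℝ} (hM : 0 ≤ M) (hωM : ∀ u, |ω u| ≤ M * ‖u‖) {ε : ℝ}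
    (hε : 0 < ε) : ∃ (w : Rd d → Rd d) (hw : IsTestField w), (∀ x, ‖w x‖ ≤ M) ∧
      ∀ u, |ω u - divFunctional w hw u| ≤ ε * ‖u‖ := by
  -- The unit ball of `BV d`, taken in `bvSubmodule d` so that it carries the `L¹` topology, in
  -- which it is compact.
  let X : Set (bvSubmodule d) := {u | deGiorgiVariation (u : Lp ℝ 1 (volume : Measure (Rd d))) ≤ 1}
  have hXnorm : ∀ u : BV d, u ∈ X ↔ ‖u‖ ≤ 1 := fun u => by
    rw [BV.norm_def, ← ENNReal.toReal_one,
      ENNReal.toReal_le_toReal u.deGiorgiVariation_ne_top ENNReal.one_ne_top]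
    rfl
  have hXc : IsCompact X := by
    rw [Topology.IsInducing.subtypeVal.isCompact_iff]
    convert isCompact_setOf_deGiorgiVariation_le_one hd using 1
    ext u
    refine ⟨?_, fun h => ⟨⟨u, h.1, h.2.trans_lt ENNReal.one_lt_top⟩, h.2, rfl⟩⟩
    rintro ⟨u, hu, rfl⟩
    exact ⟨u.2.1, hu⟩
  have hXconv : Convex ℝ X := by
    have : X = {u : BV d | ‖u‖ ≤ 1} := Set.ext hXnorm
    have h1 : Convex ℝ {u : BV d | ‖u‖ ≤ 1} := by
      simpa [Metric.closedBall, dist_zero_right] using convex_closedBall (0 : BV d) 1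
    rw [this]
    exact h1
  have h0X : (0 : bvSubmodule d) ∈ X := by
    have := (hXnorm 0).2 (by simp)
    exact this
  let Y : Set (BV d →ₗ[ℝ] ℝ) := {y | ∃ (w : Rd d → Rd d) (hw : IsTestField w),
    (∀ x, ‖w x‖ ≤ M) ∧ y = divFunctional w hw - ω}
  have hYconv : Convex ℝ Y := by
    rintro _ ⟨w, hw, hwM, rfl⟩ _ ⟨w', hw', hwM', rfl⟩ a b ha hb hab
    refine ⟨_, (hw.const_smul a).add (hw'.const_smul b), fun x => ?_, ?_⟩
    · calc ‖a • w x + b • w' x‖ ≤ a * ‖w x‖ + b * ‖w' x‖ := by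
            refine (norm_add_le _ _).trans_eq ?_
            rw [norm_smul, norm_smul, Real.norm_of_nonneg ha, Real.norm_of_nonneg hb]
        _ ≤ a * M + b * M := add_le_add (mul_le_mul_of_nonneg_left (hwM x) ha)
            (mul_le_mul_of_nonneg_left (hwM' x) hb)
        _ = M := by rw [← add_mul, hab, one_mul]
    · ext u
      have h1 : ω u = a * ω u + b * ω u := by rw [← add_mul, hab, one_mul]
      simp only [LinearMap.add_apply, LinearMap.smul_apply, LinearMap.sub_apply, smul_eq_mul]
      rw [divFunctional_add (hw.const_smul a) (hw'.const_smul b), divFunctional_const_smul hw,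
        divFunctional_const_smul hw']
      linear_combination h1
  have hYc : ∀ y ∈ Y, ContinuousOn (fun u : bvSubmodule d => (y : BV d →ₗ[ℝ] ℝ) u) X := by
    rintro y ⟨w, hw, -, rfl⟩
    rw [continuousOn_iff_continuous_domRestrict]
    -- `X` is metrizable, so sequences suffice, and its elements are bounded in `BV`.
    refine SeqContinuous.continuous fun u u₀ hu => ?_
    have h1 : Tendsto (fun n => ((u n : bvSubmodule d) : Lp ℝ 1 (volume : Measure (Rd d)))) atTop
        (𝓝 ((u₀ : bvSubmodule d) : Lp ℝ 1 (volume : Measure (Rd d)))) :=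
      ((continuous_subtype_val.comp continuous_subtype_val).tendsto u₀).comp hu
    have h2 : ∃ C : ℝ, ∀ n, ‖(show BV d from (u n).1)‖ ≤ C := ⟨1, fun n => (hXnorm _).1 (u n).2⟩
    exact (seqContinuousOnBounded_divFunctional hw (fun n => (u n).1) u₀.1 h1 h2).sub
      (hω (fun n => (u n).1) u₀.1 h1 h2)
  have hex : ∀ u ∈ X, ∃ y ∈ Y, -ε < (y : BV d →ₗ[ℝ] ℝ) u := by
    intro (u : BV d) hu
    obtain ⟨w, hw, hwM, hlt⟩ := exists_lt_divFunctional (d := d) u hM hε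
    refine ⟨_, ⟨w, hw, hwM, rfl⟩, ?_⟩
    have h1 : ω u ≤ _ := (le_abs_self _).trans (hωM u)
    rw [LinearMap.sub_apply]
    linarith
  obtain ⟨_, ⟨w, hw, hwM, rfl⟩, hw0⟩ := exists_forall_lt_of_forall_exists_lt (E := bvSubmodule d)
    ⟨0, h0X⟩ hXc hXconv (Y := Y) hYconv hYc hex
  refine ⟨w, hw, hwM, fun u => ?_⟩
  have hball : ∀ u : BV d, ‖u‖ ≤ 1 → ω u - divFunctional w hw u ≤ ε := fun u hu => by
    have h1 : -ε < divFunctional w hw u - ω u := hw0 u ((hXnorm u).2 hu)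
    linarith
  have habs : ∀ u : BV d, ‖u‖ ≤ 1 → |ω u - divFunctional w hw u| ≤ ε := fun u hu => by
    have h2 := hball (-u) (by rwa [norm_neg])
    rw [map_neg, map_neg] at h2
    exact abs_le.2 ⟨by linarith, hball u hu⟩
  rw [← div_le_iff₀' hε]
  -- Rescaling by some `r > ‖u‖` avoids dividing by a norm that could be zero.
  refine le_of_forall_gt_imp_ge_of_dense fun r hr => ?_
  have hr0 : 0 < r := (norm_nonneg _).trans_lt hr
  have h3 := habs (r⁻¹ • u) (by
    rw [norm_smul, norm_inv, Real.norm_of_nonneg hr0.le, inv_mul_le_iff₀ hr0, mul_one]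
    exact hr.le)
  rw [map_smul, map_smul, ← smul_sub, smul_eq_mul, abs_mul, abs_inv, abs_of_pos hr0,
    inv_mul_le_iff₀ hr0] at h3
  rw [div_le_iff₀ hε]
  exact h3

/-! ### Summing the successive approximations -/

theorem mem_CH_of_seqContinuousOnBounded {d : ℕ} (hd : 1 ≤ d) {ω : StrongDual ℝ (BV d)}
    (hω : SeqContinuousOnBounded ω) : ω ∈ CH d := by
  -- The `1` keeps every tolerance `M * (1 / 2) ^ (n + 1)` positive, even for `ω = 0`.
  set M := ‖ω‖ + 1 with hM
  have hM0 : 0 < M := by positivity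
  -- A state is the remainder after `n` subtractions. The tolerance of one step is the norm bound
  -- for the next remainder, hence the size of the next field, which makes the series of fields
  -- converge uniformly.
  let State : ℕ → Type := fun n => {p : BV d →ₗ[ℝ] ℝ // SeqContinuousOnBounded p ∧
    ∀ u, |p u| ≤ M * (1 / 2) ^ n * ‖u‖}
  have step : ∀ (n : ℕ) (p : State n), ∃ (w : Rd d → Rd d) (hw : IsTestField w)
      (p' : State (n + 1)), (∀ x, ‖w x‖ ≤ M * (1 / 2) ^ n) ∧
        ∀ u, p'.1 u = p.1 u - divFunctional w hw u := by
    rintro n ⟨p, hp, hpM⟩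
    obtain ⟨w, hw, hwM, hpw⟩ := exists_divFunctional_approx hd hp (by positivity) hpM
      (ε := M * (1 / 2) ^ (n + 1)) (by positivity)
    exact ⟨w, hw, ⟨p - divFunctional w hw, fun u u₀ hu hC => (hp u u₀ hu hC).sub
      (seqContinuousOnBounded_divFunctional hw u u₀ hu hC), hpw⟩, hwM, fun u => rfl⟩
  choose w hw next hwM hnext using step
  let p : ∀ n, State n := fun n => Nat.rec ⟨ω.toLinearMap, hω, fun u => by
    rw [pow_zero, mul_one]
    exact (ω.le_opNorm u).trans (by gcongr; linarith)⟩ next n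
  let W : ℕ → Rd d → Rd d := fun n => w n (p n)
  have hW : ∀ n, IsTestField (W n) := fun n => hw n (p n)
  have hWM : ∀ n x, ‖W n x‖ ≤ M * (1 / 2) ^ n := fun n => hwM n (p n)
  have hsum : Summable fun n : ℕ => M * (1 / 2 : ℝ) ^ n := summable_geometric_two.mul_left M
  have hp : ∀ n u, (p n).1 u = ω u - ∑ k ∈ Finset.range n, divFunctional (W k) (hW k) u := by
    intro n u
    induction n with
    | zero => simp; rfl
    | succ n ih =>
      rw [Finset.sum_range_succ, ← sub_sub, ← ih]
      exact hnext n (p n) u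
  have hlim : ∀ u, Tendsto (fun n => ∑ k ∈ Finset.range n, divFunctional (W k) (hW k) u) atTop
      (𝓝 (ω u)) := by
    intro u
    have h1 : Tendsto (fun n => (p n).1 u) atTop (𝓝 0) := by
      refine squeeze_zero_norm (fun n => (p n).2.2 u) ?_
      simpa using (hsum.tendsto_atTop_zero).mul_const ‖u‖
    have h2 := h1.const_sub (ω u)
    simp only [hp, sub_sub_cancel, sub_zero] at h2
    exact h2
  refine ⟨fun x => ∑' n, W n x,
    (continuous_tsum (fun n => (hW n).1.continuous) hsum hWM).continuousOn, fun u => ?_⟩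
  obtain ⟨Du, hDu⟩ := exists_isGradientMeasure u.integrable u.deGiorgiVariation_ne_top
  refine ⟨Du, hDu, ?_⟩
  have hfin : IsFiniteMeasure Du.variation := ⟨hDu.finite⟩
  have hfin' : IsFiniteMeasure (Du.restrict (unitCube d)).variation := isFiniteMeasure_of_le _
    (VectorMeasure.variation_restrict_le.trans Measure.restrict_le_self)
  have h1 := VectorMeasure.hasSum_integral_of_dominated_convergence
    (μ := Du.restrict (unitCube d)) (B := innerSL ℝ) (f := fun x => ∑' n, W n x)
    (fun n _ => M * (1 / 2) ^ n) (fun n => (hW n).1.continuous.aestronglyMeasurable)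
    (fun n => ae_of_all _ (hWM n)) (ae_of_all _ fun _ => hsum) (integrable_const _)
    (ae_of_all _ fun x => (hsum.of_norm_bounded fun n => hWM n x).hasSum)
  -- The partial sums tend to `ω u` because the remainders vanish, and to the integral of the summed
  -- field by dominated convergence.
  refine tendsto_nhds_unique (hlim u) ((h1.neg.tendsto_sum_nat).congr fun n => ?_)
  refine Finset.sum_congr rfl fun k _ => ?_
  rw [hDu.integral_restrict_unitCube u.ae_eq_zero (hW k), neg_neg, divFunctional_apply]

end

theorem mainTheorem10 (d : ℕ) (hd : 1 ≤ d) (ω : StrongDual ℝ (BV d)) :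
    ω ∈ CH d ↔
      ∀ (u : ℕ → BV d) (u₀ : BV d),
        Tendsto (fun n => BV.toL1 (u n)) atTop (𝓝 (BV.toL1 u₀)) →
        (∃ C : ℝ, ∀ n, ‖u n‖ ≤ C) →
        Tendsto (fun n => ω (u n)) atTop (𝓝 (ω u₀)) :=
  ⟨fun h => seqContinuousOnBounded_of_approx fun _ hε =>
    exists_divFunctional_approx_of_mem_CH h hε, mem_CH_of_seqContinuousOnBounded hd⟩
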